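/- Let $k$ be a field, let $A$ and $B$ be finite-dimensional associative unital $k$-algebras, and let $\Gamma_1,\Gamma_2$ be abelian groups (written additively). Suppose that $A=\bigoplus_{\gamma\in\Gamma_1}A_\gamma$ is a $\Gamma_1$-graded $k$-algebra and $B=\bigoplus_{\gamma\in\Gamma_2}B_\gamma$ is a $\Gamma_2$-graded $k$-algebra, and let $t\colon\Gamma_1\times\Gamma_2\to k^\times$ be a bicharacter, i.e. a map with $t(0,\gamma_2)=t(\gamma_1,0)=1$, $t(\gamma_1+\gamma_1',\gamma_2)=t(\gamma_1,\gamma_2)\,t(\gamma_1',\gamma_2)$ and $t(\gamma_1,\gamma_2+\gamma_2')=t(\gamma_1,\gamma_2)\,t(\gamma_1,\gamma_2')$ for all $\gamma_1,\gamma_1'\in\Gamma_1$ and $\gamma_2,\gamma_2'\in\Gamma_2$. Let $A\otimes^tB$ be the twisted tensor product: the $k$-algebra with underlying vector space $A\otimes_kB$ and multiplication determined by $$(a\otimes b)(a'\otimes b')=t(|a'|,|b|)\,(aa'\otimes bb')$$ for homogeneous $a,a'\in A$ and $b,b'\in B$, where $|\cdot|$ denotes the degree. For a ring $R$ let $\mathsf{D}(R)$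 be the unbounded derived category of the category of right $R$-modules, and let $\mathsf{Loc}(\mathsf{Inj}\,R)$ be the smallest triangulated subcategory of $\mathsf{D}(R)$ that is closed under (set-indexed) coproducts and contains all injective right $R$-modules, viewed as complexes concentrated in degree $0$. We say that injectives generate for $R$ if $\mathsf{Loc}(\mathsf{Inj}\,R)=\mathsf{D}(R)$. If injectives generate for $A$ and for $B$, then injectives generate for $A\otimes^tB$. -/

import Mathlib

open CategoryTheory CategoryTheory.Limits TensorProduct

universe u v w

/-! ### Localizing subcategories and injective generation -/

section Localizing

variable {T : Type v} [Category.{w} T] [Preadditive T] [HasZeroObject T] [HasShift T ℤ]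
  [∀ n : ℤ, (shiftFunctor T n).Additive] [Pretriangulated T]

/-- A (strictly full) subcategory of a triangulated category is *localizing* if it is a
triangulated subcategory which is closed under all coproducts indexed by types in `Type u`
(the small types). -/
structure IsLocalizing (P : ObjectProperty T) : Prop where
  isClosedUnderIsomorphisms : P.IsClosedUnderIsomorphisms
  isTriangulated : P.IsTriangulated
  coproducts : ∀ J : Type u, P.IsClosedUnderColimitsOfShape (Discrete J)

/-- The smallest localizing subcategory `Loc(S)` containing a class `S` of objects. -/
def Loc (S : ObjectProperty T) : ObjectProperty T :=
  fun X => ∀ P : ObjectProperty T, IsLocalizing.{u} P → S ≤ P → P X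

end Localizing

/-- The class of objects of the derived category of an abelian category `C` which are isomorphic
to an injective object of `C`, regarded as a complex concentrated in degree `0`. -/
def injectivesInDegreeZero (C : Type v) [Category.{u} C] [Abelian C] [HasDerivedCategory.{w} C] :
    ObjectProperty (DerivedCategory C) :=
  fun X => ∃ I : C, Injective I ∧ Nonempty (X ≅ (DerivedCategory.singleFunctor C 0).obj I)

/-- *Injectives generate* for a ring `R` if `Loc(Inj R) = D(R)`, where `D(R)` is the (unbounded)
derived category of the category of right `R`-modules, i.e. of `Rᵐᵒᵖ`-modules. -/
def InjectivesGenerate (R : Type u) [Ring R] : Prop :=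
  letI : HasDerivedCategory (ModuleCat.{u} Rᵐᵒᵖ) := HasDerivedCategory.standard _
  Loc.{u} (injectivesInDegreeZero (ModuleCat.{u} Rᵐᵒᵖ)) = ⊤

/-! ### Twisted tensor products -/

/-- A bicharacter `Γ₁ × Γ₂ → kˣ`. -/
structure Bicharacter (Γ₁ : Type v) (Γ₂ : Type w) (k : Type u)
    [AddCommGroup Γ₁] [AddCommGroup Γ₂] [Field k] where
  toFun : Γ₁ → Γ₂ → kˣ
  map_zero_left : ∀ j, toFun 0 j = 1
  map_zero_right : ∀ i, toFun i 0 = 1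
  map_add_left : ∀ i i' j, toFun (i + i') j = toFun i j * toFun i' j
  map_add_right : ∀ i j j', toFun i (j + j') = toFun i j * toFun i j'

section TwistedTensorProduct

variable {k : Type u} [Field k] {Γ₁ : Type v} {Γ₂ : Type w} [AddCommGroup Γ₁] [AddCommGroup Γ₂]
  [DecidableEq Γ₁] [DecidableEq Γ₂]
  {A B : Type u} [Ring A] [Algebra k A] [Ring B] [Algebra k B]

/-- The twisted tensor product `A ⊗ᵗ B`; its underlying vector space is `A ⊗ B`. -/
@[nolint unusedArguments]
def TwistedTensorProduct (𝒜 : Γ₁ → Submodule k A) [GradedAlgebra 𝒜]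
    (ℬ : Γ₂ → Submodule k B) [GradedAlgebra ℬ] (_t : Bicharacter Γ₁ Γ₂ k) : Type u :=
  A ⊗[k] B

namespace TwistedTensorProduct

variable (𝒜 : Γ₁ → Submodule k A) [GradedAlgebra 𝒜]
  (ℬ : Γ₂ → Submodule k B) [GradedAlgebra ℬ] (t : Bicharacter Γ₁ Γ₂ k)

noncomputable instance : AddCommGroup (TwistedTensorProduct 𝒜 ℬ t) :=
  inferInstanceAs (AddCommGroup (A ⊗[k] B))

noncomputable instance : Module k (TwistedTensorProduct 𝒜 ℬ t) :=
  inferInstanceAs (Module k (A ⊗[k] B))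

/-- The identification of the underlying vector space of `A ⊗ᵗ B` with `A ⊗ B`. -/
noncomputable def of : A ⊗[k] B ≃ₗ[k] TwistedTensorProduct 𝒜 ℬ t :=
  LinearEquiv.refl k (A ⊗[k] B)

/-- The pure tensor `a ⊗ b` as an element of `A ⊗ᵗ B`. -/
noncomputable def tmul (a : A) (b : B) : TwistedTensorProduct 𝒜 ℬ t :=
  of 𝒜 ℬ t (a ⊗ₜ[k] b)

/-- For `j : Γ₂`, the linear map `A → A` given by `a ↦ t(|a|, j) a` for homogeneous `a`. -/
noncomputable def scale (j : Γ₂) : A →ₗ[k] A :=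
  DirectSum.toModule k Γ₁ A (fun i => (t.toFun i j : k) • (𝒜 i).subtype) ∘ₗ
    (DirectSum.decomposeLinearEquiv 𝒜).toLinearMap

/-- The bilinear map `B × A → A ⊗ B` given by `(b, a) ↦ t(|a|, |b|) a ⊗ b` for homogeneous
`a` and `b`. -/
noncomputable def swap : B →ₗ[k] A →ₗ[k] A ⊗[k] B :=
  DirectSum.toModule k Γ₂ (A →ₗ[k] A ⊗[k] B)
      (fun j => (((TensorProduct.mk k A B).comp (scale 𝒜 t j)).flip).comp (ℬ j).subtype) ∘ₗ
    (DirectSum.decomposeLinearEquiv ℬ).toLinearMap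

/-- The multiplication as a bilinear map: `(a ⊗ b, a' ⊗ b')` is sent to
`(a ⊗ 1) · swap(b, a') · (1 ⊗ b')`. -/
noncomputable def mulAux : A ⊗[k] B →ₗ[k] A ⊗[k] B →ₗ[k] A ⊗[k] B :=
  TensorProduct.lift (LinearMap.mk₂ k
    (fun (a : A) (b : B) => TensorProduct.lift (LinearMap.mk₂ k
      (fun (a' : A) (b' : B) =>
        TensorProduct.map (LinearMap.mulLeft k a) (LinearMap.mulRight k b') (swap 𝒜 ℬ t b a'))
      (by intros; simp [map_add])
      (by intros; simp [map_smul])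
      (by
        intro m n n'
        rw [show LinearMap.mulRight k (n + n') = LinearMap.mulRight k n + LinearMap.mulRight k n' by
          ext; simp [mul_add], TensorProduct.map_add_right, LinearMap.add_apply])
      (by
        intro c m n
        rw [show LinearMap.mulRight k (c • n) = c • LinearMap.mulRight k n by
          ext; simp, TensorProduct.map_smul_right, LinearMap.smul_apply])))
    (by
      intro m m' n
      ext x y
      simp only [TensorProduct.AlgebraTensorModule.curry_apply, TensorProduct.curry_apply,
        LinearMap.coe_restrictScalars, TensorProduct.lift.tmul, LinearMap.mk₂_apply,
        LinearMap.add_apply]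
      rw [show LinearMap.mulLeft k (m + m') = LinearMap.mulLeft k m + LinearMap.mulLeft k m' by
          ext; simp [add_mul], TensorProduct.map_add_left, LinearMap.add_apply])
    (by
      intro c m n
      ext x y
      simp only [TensorProduct.AlgebraTensorModule.curry_apply, TensorProduct.curry_apply,
        LinearMap.coe_restrictScalars, TensorProduct.lift.tmul, LinearMap.mk₂_apply,
        LinearMap.smul_apply]
      rw [show LinearMap.mulLeft k (c • m) = c • LinearMap.mulLeft k m by
          ext; simp, TensorProduct.map_smul_left, LinearMap.smul_apply])
    (by intros; ext; simp)
    (by intros; ext; simp))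

variable {𝒜 ℬ} in
theorem scale_of_mem {i : Γ₁} {a : A} (ha : a ∈ 𝒜 i) (j : Γ₂) :
    scale 𝒜 t j a = (t.toFun i j : k) • a := by
  lift a to 𝒜 i using ha
  simp [scale]

variable {𝒜 ℬ} in
theorem swap_of_mem {i : Γ₁} {j : Γ₂} {a : A} {b : B} (ha : a ∈ 𝒜 i) (hb : b ∈ ℬ j) :
    swap 𝒜 ℬ t b a = (t.toFun i j : k) • (a ⊗ₜ[k] b) := by
  lift b to ℬ j using hb
  simp [swap, scale_of_mem t ha, TensorProduct.smul_tmul']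

variable {𝒜 ℬ} in
theorem mulAux_tmul {i : Γ₁} {j : Γ₂} (a : A) {a' : A} {b : B} (b' : B)
    (ha' : a' ∈ 𝒜 i) (hb : b ∈ ℬ j) :
    mulAux 𝒜 ℬ t (a ⊗ₜ b) (a' ⊗ₜ b') = (t.toFun i j : k) • ((a * a') ⊗ₜ[k] (b * b')) := by
  simp [mulAux, swap_of_mem t ha' hb]

/-- Induction on homogeneous pure tensors. -/
theorem homogeneous_induction {p : A ⊗[k] B → Prop}
    (htmul : ∀ i j, ∀ a ∈ 𝒜 i, ∀ b ∈ ℬ j, p (a ⊗ₜ b)) (hadd : ∀ x y, p x → p y → p (x + y))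
    (x : A ⊗[k] B) : p x := by
  have h0 : p 0 := by simpa using htmul 0 0 0 (zero_mem _) 0 (zero_mem _)
  induction x using TensorProduct.induction_on with
  | zero => exact h0
  | add x y hx hy => exact hadd x y hx hy
  | tmul a b =>
    induction a using DirectSum.Decomposition.inductionOn 𝒜 with
    | zero => simpa using h0
    | add m m' h h' => rw [TensorProduct.add_tmul]; exact hadd _ _ h h'
    | homogeneous a =>
      induction b using DirectSum.Decomposition.inductionOn ℬ with
      | zero => simpa using h0
      | add m m' h h' => rw [TensorProduct.tmul_add]; exact hadd _ _ h h'
      | homogeneous b => exact htmul _ _ _ a.2 _ b.2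

theorem mulAux_assoc (x y z : A ⊗[k] B) :
    mulAux 𝒜 ℬ t (mulAux 𝒜 ℬ t x y) z = mulAux 𝒜 ℬ t x (mulAux 𝒜 ℬ t y z) := by
  induction x using homogeneous_induction 𝒜 ℬ with
  | hadd x x' h h' => simp only [map_add, LinearMap.add_apply, h, h']
  | htmul i₁ j₁ a₁ ha₁ b₁ hb₁ =>
  induction y using homogeneous_induction 𝒜 ℬ with
  | hadd x x' h h' => simp only [map_add, LinearMap.add_apply, h, h']
  | htmul i₂ j₂ a₂ ha₂ b₂ hb₂ =>
  induction z using homogeneous_induction 𝒜 ℬ with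
  | hadd x x' h h' => simp only [map_add, h, h']
  | htmul i₃ j₃ a₃ ha₃ b₃ hb₃ =>
  rw [mulAux_tmul t _ _ ha₂ hb₁, mulAux_tmul t _ _ ha₃ hb₂, map_smul, map_smul,
    LinearMap.smul_apply, mulAux_tmul t _ _ ha₃ (SetLike.mul_mem_graded hb₁ hb₂),
    mulAux_tmul t _ _ (SetLike.mul_mem_graded ha₂ ha₃) hb₁, t.map_add_left, t.map_add_right,
    smul_smul, smul_smul, mul_assoc, mul_assoc]
  congr 1
  push_cast
  ring

theorem one_mulAux (x : A ⊗[k] B) : mulAux 𝒜 ℬ t (1 ⊗ₜ 1) x = x := by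
  induction x using homogeneous_induction 𝒜 ℬ with
  | hadd x x' h h' => simp only [map_add, h, h']
  | htmul i j a ha b hb =>
    rw [mulAux_tmul t _ _ ha SetLike.GradedOne.one_mem, t.map_zero_right]; simp

theorem mulAux_one (x : A ⊗[k] B) : mulAux 𝒜 ℬ t x (1 ⊗ₜ 1) = x := by
  induction x using homogeneous_induction 𝒜 ℬ with
  | hadd x x' h h' => simp only [map_add, LinearMap.add_apply, h, h']
  | htmul i j a ha b hb =>
    rw [mulAux_tmul t _ _ SetLike.GradedOne.one_mem hb, t.map_zero_left]; simp

noncomputable instance : Ring (TwistedTensorProduct 𝒜 ℬ t) where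
  __ := (inferInstance : AddCommGroup (TwistedTensorProduct 𝒜 ℬ t))
  mul x y := of 𝒜 ℬ t (mulAux 𝒜 ℬ t ((of 𝒜 ℬ t).symm x) ((of 𝒜 ℬ t).symm y))
  one := tmul 𝒜 ℬ t 1 1
  left_distrib x y z := by
    change of 𝒜 ℬ t _ = of 𝒜 ℬ t _ + of 𝒜 ℬ t _
    rw [map_add, map_add, map_add]
  right_distrib x y z := by
    change of 𝒜 ℬ t _ = of 𝒜 ℬ t _ + of 𝒜 ℬ t _
    rw [map_add, map_add, LinearMap.add_apply, map_add]
  zero_mul x := by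
    change of 𝒜 ℬ t _ = _
    rw [map_zero, map_zero, LinearMap.zero_apply, map_zero]
  mul_zero x := by
    change of 𝒜 ℬ t _ = _
    rw [map_zero, map_zero, map_zero]
  mul_assoc x y z := mulAux_assoc 𝒜 ℬ t x y z
  one_mul x := one_mulAux 𝒜 ℬ t x
  mul_one x := mulAux_one 𝒜 ℬ t x

noncomputable instance : Algebra k (TwistedTensorProduct 𝒜 ℬ t) :=
  Algebra.ofModule
    (fun c x y => by
      change of 𝒜 ℬ t (mulAux 𝒜 ℬ t ((of 𝒜 ℬ t).symm (c • x)) _) = c • of 𝒜 ℬ t _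
      rw [map_smul, map_smul, LinearMap.smul_apply, map_smul])
    (fun c x y => by
      change of 𝒜 ℬ t (mulAux 𝒜 ℬ t _ ((of 𝒜 ℬ t).symm (c • y))) = c • of 𝒜 ℬ t _
      rw [map_smul, map_smul, map_smul])

theorem one_def : (1 : TwistedTensorProduct 𝒜 ℬ t) = tmul 𝒜 ℬ t 1 1 := rfl

variable {𝒜 ℬ} in
/-- The defining formula `(a ⊗ b) (a' ⊗ b') = t(|a'|, |b|) aa' ⊗ bb'` (for homogeneous `a'`
and `b`). -/
theorem tmul_mul_tmul {i : Γ₁} {j : Γ₂} (a : A) {a' : A} {b : B} (b' : B)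
    (ha' : a' ∈ 𝒜 i) (hb : b ∈ ℬ j) :
    tmul 𝒜 ℬ t a b * tmul 𝒜 ℬ t a' b' = (t.toFun i j : k) • tmul 𝒜 ℬ t (a * a') (b * b') :=
  mulAux_tmul t a b' ha' hb

end TwistedTensorProduct

end TwistedTensorProduct

/-!
Right modules over a ring `R` are treated as left modules over `Rᵐᵒᵖ`. Write `A`, `B`, `L` for the
opposite algebras of `A`, `B` and `A ⊗ᵗ B`. Then `A` and `B` are subalgebras of `L`, the
multiplication maps `A ⊗ B → L` and `B ⊗ A → L` are bijective, and elements of `B` commute with a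
homogeneous element of `A` up to an automorphism of the vector space `B`. This is all that is used
about `L`.

Let `P` be a localizing subcategory of `D(L)` which contains all injective modules. It suffices to
show that `P` contains `L`, as the regular module generates `D(L)`
(`IsLocalizing.eq_top_of_prop_single_self`).

* As `L` is finite free over `A`, the coinduction functor `Hom_A(L, -)` is exact and preserves
  coproducts, so the objects of `D(A)` which it sends to `P` form a localizing subcategory. It also
  preserves injectives. As injectives generate for `A`, all modules `Hom_A(L, M)` belong to `P`.
* The induction functor `L ⊗_B -` is exact and preserves coproducts as well. It sends a `B`-module
  of the form `Hom_k(B, V)` to the `L`-module `Hom_A(L, A ⊗ V)` (`matrixRestrictCoextendIso`), which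
  belongs to `P` by the first step. Every injective `B`-module is a retract of some `Hom_k(B, V)`,
  so it is sent to `P` too. As injectives generate for `B`, all modules `L ⊗_B N` belong to `P`, in
  particular `L ⊗_B B = L`.

Both functors are described by a homomorphism from `L` to a ring of matrices over `A` or `B`
(`matrixRestrict`): they send `M` to a finite power of `M` on which `L` acts through matrices. This
makes it evident that they are exact and preserve coproducts. That the induced functors between
derived categories preserve coproducts follows from the fact that coproducts in the derived category
are computed by coproducts of complexes (`DerivedCategory.preservesCoproducts_Q`).
-/

/-! ### Coproducts in derived categories -/

section QuasiIsoColimits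

variable {C : Type*} [Category* C] [Abelian C] {ι : Type*} (c : ComplexShape ι)
  (J : Type*) [Category* J] [HasColimitsOfShape J C] [HasExactColimitsOfShape J C]

/-- If colimits of shape `J` are exact, then a colimit of shape `J` of quasi-isomorphisms is a
quasi-isomorphism: homology in the category of `J`-diagrams is computed pointwise, and it is
preserved by the exact functor `colim`. -/
instance HomologicalComplex.quasiIso_isStableUnderColimitsOfShape :
    (HomologicalComplex.quasiIso C c).IsStableUnderColimitsOfShape J where
  condition X₁ X₂ c₁ c₂ h₁ h₂ f hf φ hφ := by
    rw [HomologicalComplex.mem_quasiIso_iff, quasiIso_iff]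
    intro i
    rw [quasiIsoAt_iff]
    let S (X : J ⥤ HomologicalComplex C c) : ShortComplex (J ⥤ C) :=
      ShortComplex.mk (X₁ := X ⋙ eval C c (c.prev i)) (X₂ := X ⋙ eval C c i)
        (X₃ := X ⋙ eval C c (c.next i))
        { app := fun j => (X.obj j).d _ _, naturality := fun _ _ g => (X.map g).comm _ _ }
        { app := fun j => (X.obj j).d _ _, naturality := fun _ _ g => (X.map g).comm _ _ }
        (NatTrans.ext (funext fun j => (X.obj j).d_comp_d _ _ _))
    let ψ : S X₁ ⟶ S X₂ :=
      { τ₁ := Functor.whiskerRight f _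
        τ₂ := Functor.whiskerRight f _
        τ₃ := Functor.whiskerRight f _
        comm₁₂ := NatTrans.ext (funext fun j => (f.app j).comm _ _)
        comm₂₃ := NatTrans.ext (funext fun j => (f.app j).comm _ _) }
    have hψ : ShortComplex.QuasiIso ψ := by
      rw [ShortComplex.quasiIso_iff_evaluation]
      intro j
      have := hf j
      rw [HomologicalComplex.mem_quasiIso_iff, quasiIso_iff] at this
      exact (quasiIsoAt_iff _ _).1 (this i)
    let e (X : J ⥤ HomologicalComplex C c) (d : Cocone X) (hd : IsColimit d) (k : ι) :
        colim.obj (X ⋙ eval C c k) ≅ d.pt.X k :=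
      (colimit.isColimit (X ⋙ eval C c k)).coconePointUniqueUpToIso
        (isColimitOfPreserves (eval C c k) hd)
    have he (X : J ⥤ HomologicalComplex C c) (d : Cocone X) (hd : IsColimit d) (k : ι) (j : J) :
        colimit.ι (X ⋙ eval C c k) j ≫ (e X d hd k).hom = (d.ι.app j).f k :=
      IsColimit.comp_coconePointUniqueUpToIso_hom _ _ _
    have he' (X : J ⥤ HomologicalComplex C c) (d : Cocone X) (hd : IsColimit d) (k : ι) (j : J)
        {Z : C} (g : d.pt.X k ⟶ Z) :
        colimit.ι (X ⋙ eval C c k) j ≫ (e X d hd k).hom ≫ g = (d.ι.app j).f k ≫ g := by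
      rw [← Category.assoc, he]
      rfl
    let E (X : J ⥤ HomologicalComplex C c) (d : Cocone X) (hd : IsColimit d) :
        (S X).map colim ≅ (shortComplexFunctor C c i).obj d.pt :=
      ShortComplex.isoMk (e X d hd _) (e X d hd _) (e X d hd _)
        (colimit.hom_ext fun j => by
          refine (he' X d hd _ j _).trans ?_
          refine ((d.ι.app j).comm _ _).trans ?_
          refine Eq.trans ?_ (ι_colimMap_assoc (S X).f j _).symm
          exact congr_arg ((S X).f.app j ≫ ·) (he X d hd _ j).symm)
        (colimit.hom_ext fun j => by
          refine (he' X d hd _ j _).trans ?_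
          refine ((d.ι.app j).comm _ _).trans ?_
          refine Eq.trans ?_ (ι_colimMap_assoc (S X).g j _).symm
          exact congr_arg ((S X).g.app j ≫ ·) (he X d hd _ j).symm)
    have hφ' (j : J) (k : ι) : (c₁.ι.app j).f k ≫ φ.f k = (f.app j).f k ≫ (c₂.ι.app j).f k :=
      congr_arg (fun g => HomologicalComplex.Hom.f g k) (hφ j)
    have hcolim : ShortComplex.QuasiIso ((colim (J := J) (C := C)).mapShortComplex.map ψ) :=
      inferInstance
    have key (k : ι) : (e X₁ c₁ h₁ k).hom ≫ φ.f k =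
        colimMap (Functor.whiskerRight f (eval C c k)) ≫ (e X₂ c₂ h₂ k).hom := by
      refine colimit.hom_ext fun j => ?_
      refine (he' X₁ c₁ h₁ k j _).trans ((hφ' j k).trans ?_)
      refine Eq.trans ?_ (ι_colimMap_assoc (Functor.whiskerRight f (eval C c k)) j _).symm
      exact congr_arg ((f.app j).f k ≫ ·) (he X₂ c₂ h₂ k j).symm
    refine (ShortComplex.quasiIso_iff_of_arrow_mk_iso _ _
      (Arrow.isoMk (E X₁ c₁ h₁) (E X₂ c₂ h₂) ?_)).1 hcolim
    ext
    · exact key _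
    · exact key _
    · exact key _

end QuasiIsoColimits

section HomotopyCoproduct

variable {C : Type*} [Category* C] [Preadditive C] {ι : Type*} {c : ComplexShape ι}
  {J : Type*} [HasColimitsOfShape (Discrete J) C]

/-- A morphism out of a coproduct of complexes is null-homotopic if its restrictions to all
summands are: the homotopies can be chosen independently of each other. -/
theorem Homotopy.nonempty_of_cofan {X : Discrete J ⥤ HomologicalComplex C c} {d : Cocone X}
    (hd : IsColimit d) {Y : HomologicalComplex C c} (f : d.pt ⟶ Y)
    (h : ∀ j, Nonempty (Homotopy (d.ι.app j ≫ f) 0)) : Nonempty (Homotopy f 0) := by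
  let H (j : Discrete J) := (h j).some
  let hd' (k : ι) := isColimitOfPreserves (HomologicalComplex.eval C c k) hd
  let hom (i k : ι) : d.pt.X i ⟶ Y.X k := (hd' i).desc
    (Cocone.mk (Y.X k) (Discrete.natTrans fun j => (H j).hom i k))
  have hhom (j : Discrete J) (i k : ι) : (d.ι.app j).f i ≫ hom i k = (H j).hom i k :=
    (hd' i).fac _ j
  have ext {i : ι} {Z : C} {g g' : d.pt.X i ⟶ Z}
      (h : ∀ j, (d.ι.app j).f i ≫ g = (d.ι.app j).f i ≫ g') : g = g' := (hd' i).hom_ext h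
  refine ⟨⟨hom, fun i k hik => ext fun j => ?_, fun i => ext fun j => ?_⟩⟩
  · rw [hhom, (H j).zero i k hik, comp_zero]
  · rw [← HomologicalComplex.comp_f, (H j).comm i, HomologicalComplex.zero_f,
      HomologicalComplex.zero_f, add_zero, add_zero, Preadditive.comp_add, ← dNext_comp_left,
      ← prevD_comp_left]
    simp only [hhom]

end HomotopyCoproduct

namespace DerivedCategory

variable {C : Type*} [Category* C] [Abelian C] [HasDerivedCategory C] {J : Type*}
  [HasColimitsOfShape (Discrete J) C] [HasExactColimitsOfShape (Discrete J) C]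

/-- A morphism of complexes which vanishes in the derived category becomes null-homotopic after
precomposition with a quasi-isomorphism. -/
theorem exists_quasiIso_comp_homotopy_zero {K L : CochainComplex C ℤ} (f : K ⟶ L)
    (hf : Q.map f = 0) :
    ∃ (X : CochainComplex C ℤ) (s : X ⟶ K), QuasiIso s ∧ Nonempty (Homotopy (s ≫ f) 0) := by
  have h : Qh.map ((HomotopyCategory.quotient C (ComplexShape.up ℤ)).map f) =
      Qh.map ((HomotopyCategory.quotient C (ComplexShape.up ℤ)).map 0) := by
    rw [← cancel_mono ((quotientCompQhIso C).hom.app L), quotientCompQhIso_hom_naturality,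
      quotientCompQhIso_hom_naturality, hf]
    simp
  rw [MorphismProperty.map_eq_iff_precomp Qh
    (HomotopyCategory.quasiIso C (ComplexShape.up ℤ))] at h
  obtain ⟨X, s, hs, h⟩ := h
  obtain ⟨X, rfl⟩ := HomotopyCategory.quotient_obj_surjective X
  obtain ⟨s, rfl⟩ := (HomotopyCategory.quotient _ _).map_surjective s
  refine ⟨X, s, ?_, ⟨HomotopyCategory.homotopyOfEq _ _ ?_⟩⟩
  · rwa [HomotopyCategory.quotient_map_mem_quasiIso_iff] at hs
  · rw [Functor.map_comp, h, ← Functor.map_comp, comp_zero]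

/-- If coproducts are exact, then the localization functor from complexes to the derived category
preserves them. Existence and uniqueness of morphisms out of the coproduct follow from the calculus
of fractions, as the coproduct of the quasi-isomorphisms in the denominators is a
quasi-isomorphism. -/
instance preservesCoproducts_Q :
    PreservesColimitsOfShape (Discrete J) (Q : CochainComplex C ℤ ⥤ DerivedCategory C) where
  preservesColimit {F} := ⟨fun {c} hc => by
    -- A coproduct of quasi-isomorphisms to the `F.obj j` is a quasi-isomorphism to `c.pt`.
    have sigma {X : Discrete J → CochainComplex C ℤ} (s : ∀ j, X j ⟶ F.obj j)
        (hs : ∀ j, QuasiIso (s j)) :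
        ∃ (T : Cocone (Discrete.functor fun j => X ⟨j⟩)) (_ : IsColimit T) (t : T.pt ⟶ c.pt),
          QuasiIso t ∧ ∀ j, T.ι.app j ≫ t = s j ≫ c.ι.app j := by
      let T := colimit.cocone (Discrete.functor fun j => X ⟨j⟩)
      let hT : IsColimit T := colimit.isColimit _
      let σ : (Discrete.functor fun j => X ⟨j⟩) ⟶ F := Discrete.natTrans fun j => s j
      let t : T.pt ⟶ c.pt := hT.desc ((Cocone.precompose σ).obj c)
      have ht (j : Discrete J) : T.ι.app j ≫ t = s j ≫ c.ι.app j := hT.fac _ j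
      refine ⟨T, hT, t, ?_, ht⟩
      exact MorphismProperty.IsStableUnderColimitsOfShape.condition
        (W := HomologicalComplex.quasiIso C (ComplexShape.up ℤ)) _ _ _ _ hT hc σ
        (fun j => hs j) t ht
    refine ⟨IsColimit.ofExistsUnique fun s => ?_⟩
    obtain ⟨s, sι⟩ := s
    suffices ∀ (L : CochainComplex C ℤ) (f : ∀ j, Q.obj (F.obj j) ⟶ Q.obj L),
        ∃! d : Q.obj c.pt ⟶ Q.obj L, ∀ j, Q.map (c.ι.app j) ≫ d = f j by
      obtain ⟨d, hd, hd'⟩ := this (Q.objPreimage s)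
        (fun j => sι.app j ≫ (Q.objObjPreimageIso s).inv)
      refine ⟨d ≫ (Q.objObjPreimageIso s).hom, fun j => ?_, fun d' hd'' => ?_⟩
      · simp [reassoc_of% (hd j)]
      · rw [← hd' (d' ≫ (Q.objObjPreimageIso s).inv)]
        · simp
        · intro j
          rw [← hd'' j]
          simp
    -- It is enough to consider morphisms to the images of complexes. Existence uses right
    -- fractions; for uniqueness, a difference is written as a left fraction whose numerator becomes
    -- null-homotopic on each summand after composition with a quasi-isomorphism.
    intro L f
    refine existsUnique_of_exists_of_unique ?_ fun d₁ d₂ h₁ h₂ => ?_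
    · choose X s hs g hfg using fun j => right_fac (f j)
      obtain ⟨T, hT, t, ht, hst⟩ := sigma s fun j => (isIso_Q_map_iff_quasiIso C _).1 (hs j)
      let γ : T.pt ⟶ L := hT.desc (Cocone.mk L (Discrete.natTrans fun j => g j))
      have hγ (j : Discrete J) : T.ι.app j ≫ γ = g j := hT.fac _ j
      refine ⟨inv (Q.map t) ≫ Q.map γ, fun j => ?_⟩
      rw [hfg, IsIso.eq_inv_comp, ← Category.assoc, ← Functor.map_comp, ← hst, ← hγ j]
      simp
    · rw [← sub_eq_zero]
      obtain ⟨L', g, s, hs, hg⟩ := left_fac (d₁ - d₂)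
      have hz (j : Discrete J) : Q.map (c.ι.app j ≫ g) = 0 := by
        have : Q.map (c.ι.app j) ≫ (d₁ - d₂) = 0 := by
          rw [Preadditive.comp_sub, h₁, h₂, sub_self]
        rw [hg, ← Category.assoc] at this
        rw [Functor.map_comp, ← cancel_mono (inv (Q.map s)), this, zero_comp]
      choose X r hr h using fun j => exists_quasiIso_comp_homotopy_zero _ (hz j)
      obtain ⟨T, hT, t, ht, hst⟩ := sigma r hr
      have : Nonempty (Homotopy (t ≫ g) 0) := Homotopy.nonempty_of_cofan hT _ fun j => by
        rw [reassoc_of% (hst j)]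
        exact h j
      have h0 := Q_map_eq_of_homotopy _ this.some
      rw [Functor.map_comp, Functor.map_zero, ← cancel_epi (inv (Q.map t))] at h0
      rw [hg]
      simp only [IsIso.inv_hom_id_assoc, comp_zero] at h0
      rw [h0, zero_comp]⟩

end DerivedCategory

section MapDerivedCategory

variable {C D : Type*} [Category* C] [Abelian C] [HasDerivedCategory C] [Category* D] [Abelian D]
  [HasDerivedCategory D] (F : C ⥤ D) [F.Additive] [PreservesFiniteLimits F]
  [PreservesFiniteColimits F] {J : Type*}
  [HasColimitsOfShape (Discrete J) C] [HasExactColimitsOfShape (Discrete J) C]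
  [HasColimitsOfShape (Discrete J) D] [HasExactColimitsOfShape (Discrete J) D]
  [PreservesColimitsOfShape (Discrete J) F]

/-- An exact functor which preserves coproducts induces a functor between derived categories which
preserves coproducts. -/
theorem CategoryTheory.Functor.preservesCoproducts_mapDerivedCategory :
    PreservesColimitsOfShape (Discrete J) F.mapDerivedCategory where
  preservesColimit {X} := by
    let K : Discrete J ⥤ CochainComplex C ℤ :=
      Discrete.functor fun j => DerivedCategory.Q.objPreimage (X.obj ⟨j⟩)
    let e : K ⋙ DerivedCategory.Q ≅ X :=
      Discrete.natIso fun j => DerivedCategory.Q.objObjPreimageIso (X.obj j)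
    have : PreservesColimitsOfShape (Discrete J) (DerivedCategory.Q ⋙ F.mapDerivedCategory) :=
      preservesColimitsOfShape_of_natIso F.mapDerivedCategoryFactors.symm
    have : PreservesColimit (K ⋙ DerivedCategory.Q) F.mapDerivedCategory :=
      preservesColimit_of_preserves_colimit_cocone
        (isColimitOfPreserves DerivedCategory.Q (colimit.isColimit K))
        (isColimitOfPreserves (DerivedCategory.Q ⋙ F.mapDerivedCategory) (colimit.isColimit K))
    exact preservesColimit_of_iso_diagram _ e

end MapDerivedCategory

/-! ### Localizing subcategories -/

namespace IsLocalizing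

section Triangulated

variable {T : Type*} [Category* T] [Preadditive T] [HasZeroObject T] [HasShift T ℤ]
  [∀ n : ℤ, (shiftFunctor T n).Additive] [Pretriangulated T]
  {T' : Type*} [Category* T'] [Preadditive T'] [HasZeroObject T'] [HasShift T' ℤ]
  [∀ n : ℤ, (shiftFunctor T' n).Additive] [Pretriangulated T']

theorem coproducts_nat {P : ObjectProperty T} (hP : IsLocalizing.{u} P) :
    P.IsClosedUnderColimitsOfShape (Discrete ℕ) := by
  have := hP.coproducts (ULift.{u} ℕ)
  exact .of_equivalence (Discrete.equivalence Equiv.ulift)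

theorem inverseImage {P : ObjectProperty T'} (hP : IsLocalizing.{u} P) (F : T ⥤ T')
    [F.CommShift ℤ] [F.IsTriangulated]
    (hF : ∀ J : Type u, PreservesColimitsOfShape (Discrete J) F) :
    IsLocalizing.{u} (P.inverseImage F) where
  isClosedUnderIsomorphisms :=
    have := hP.isClosedUnderIsomorphisms
    inferInstance
  isTriangulated :=
    have := hP.isClosedUnderIsomorphisms
    have := hP.isTriangulated
    inferInstance
  coproducts J :=
    have := hP.coproducts J
    have := hF J
    inferInstance

end Triangulated

variable {C : Type*} [Category* C] [Abelian C] [HasDerivedCategory C]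
  {P : ObjectProperty (DerivedCategory C)} (hP : IsLocalizing.{u} P)

open DerivedCategory

theorem prop_single_of_isColimit {J : Type*} [HasColimitsOfShape (Discrete J) C]
    [HasExactColimitsOfShape (Discrete J) C] (P : ObjectProperty (DerivedCategory C))
    [P.IsClosedUnderColimitsOfShape (Discrete J)]
    {F : Discrete J ⥤ C} {c : Cocone F} (hc : IsColimit c)
    (h : ∀ j, P ((singleFunctor C 0).obj (F.obj j))) : P ((singleFunctor C 0).obj c.pt) :=
  P.prop_of_isColimit (isColimitOfPreserves
    (HomologicalComplex.single C (ComplexShape.up ℤ) 0 ⋙ Q) hc) h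

include hP

theorem prop_of_iso {X Y : DerivedCategory C} (e : X ≅ Y) (hX : P X) : P Y :=
  have := hP.isClosedUnderIsomorphisms
  P.prop_of_iso e hX

theorem prop_of_isZero {X : DerivedCategory C} (hX : IsZero X) : P X :=
  have := hP.isClosedUnderIsomorphisms
  have := hP.isTriangulated
  P.prop_of_isZero hX

theorem prop_X₂_of_shortExact {S : ShortComplex (CochainComplex C ℤ)} (hS : S.ShortExact)
    (h₁ : P (Q.obj S.X₁)) (h₃ : P (Q.obj S.X₃)) : P (Q.obj S.X₂) :=
  have := hP.isClosedUnderIsomorphisms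
  have := hP.isTriangulated
  P.ext_of_isTriangulatedClosed₂ _ (triangleOfSES_distinguished hS) h₁ h₃

theorem prop_X₃_of_shortExact {S : ShortComplex (CochainComplex C ℤ)} (hS : S.ShortExact)
    (h₁ : P (Q.obj S.X₁)) (h₂ : P (Q.obj S.X₂)) : P (Q.obj S.X₃) :=
  have := hP.isClosedUnderIsomorphisms
  have := hP.isTriangulated
  P.ext_of_isTriangulatedClosed₃ _ (triangleOfSES_distinguished hS) h₁ h₂

theorem prop_single_of_iso {X Y : C} (e : X ≅ Y) (h : P ((singleFunctor C 0).obj X)) :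
    P ((singleFunctor C 0).obj Y) :=
  hP.prop_of_iso ((singleFunctor C 0).mapIso e) h

theorem prop_single_of_isZero {X : C} (hX : IsZero X) : P ((singleFunctor C 0).obj X) :=
  hP.prop_of_isZero ((singleFunctor C 0).map_isZero hX)

theorem prop_single_of_prop_single_zero {X : C} (h : P ((singleFunctor C 0).obj X)) (n : ℤ) :
    P ((singleFunctor C n).obj X) :=
  have := hP.isTriangulated
  hP.prop_of_iso (((singleFunctors C).shiftIso (-n) n 0 (by simp)).app X) (P.le_shift (-n) _ h)

theorem prop_single_of_shortExact {S : ShortComplex C} (hS : S.ShortExact)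
    (h₁ : P ((singleFunctor C 0).obj S.X₁)) (h₂ : P ((singleFunctor C 0).obj S.X₂)) :
    P ((singleFunctor C 0).obj S.X₃) :=
  hP.prop_X₃_of_shortExact (hS.map_of_exact (HomologicalComplex.single C (ComplexShape.up ℤ) 0))
    h₁ h₂

/-- Localizing subcategories are closed under retracts, by the Eilenberg swindle: if `X` is a
retract of `Y`, then the endomorphism of `⨁_ℕ Y` which keeps the complement of `X` and shifts the
summands `X` by one position is a split monomorphism with cokernel `X`. -/
theorem prop_single_of_retract [HasColimitsOfShape (Discrete ℕ) C]
    [HasExactColimitsOfShape (Discrete ℕ) C] {X Y : C} (r : Retract X Y)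
    (hY : P ((singleFunctor C 0).obj Y)) : P ((singleFunctor C 0).obj X) := by
  have := hP.coproducts_nat
  let T := ∐ fun _ : ℕ => Y
  have hT : P ((singleFunctor C 0).obj T) :=
    prop_single_of_isColimit P (coproductIsCoproduct fun _ : ℕ => Y) fun _ => hY
  -- `e` and `f` are the complementary idempotents of `Y` given by the retract.
  let e : Y ⟶ Y := r.r ≫ r.i
  let f : Y ⟶ Y := 𝟙 Y - e
  have hee : e ≫ e = e := by simp [e]
  have hef : e ≫ f = 0 := by simp [f, hee]
  have hfe : f ≫ e = 0 := by simp [f, hee]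
  have hff : f ≫ f = f := by simp [f, hee]
  have hie : r.i ≫ e = r.i := by simp [e]
  have her : e ≫ r.r = r.r := by simp [e]
  have hif : r.i ≫ f = 0 := by simp [f, hie]
  have hfr : f ≫ r.r = 0 := by simp [f, her]
  let ι (n : ℕ) : Y ⟶ T := Sigma.ι (fun _ : ℕ => Y) n
  -- `σ` is the shift, `θ` is a retraction of `σ`, and `ρ` is the cokernel of `σ`.
  let σ : T ⟶ T := Sigma.desc fun n => f ≫ ι n + e ≫ ι (n + 1)
  let θ : T ⟶ T := Sigma.desc fun n => f ≫ ι n + match n with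
    | 0 => 0
    | n + 1 => e ≫ ι n
  let ρ : T ⟶ X := Sigma.desc fun n => match n with
    | 0 => r.r
    | _ + 1 => 0
  have hσ (n : ℕ) : ι n ≫ σ = f ≫ ι n + e ≫ ι (n + 1) := Sigma.ι_desc _ _
  have hθ₀ : ι 0 ≫ θ = f ≫ ι 0 := (Sigma.ι_desc _ _).trans (by simp)
  have hθ (n : ℕ) : ι (n + 1) ≫ θ = f ≫ ι (n + 1) + e ≫ ι n := Sigma.ι_desc _ _
  have hρ₀ : ι 0 ≫ ρ = r.r := Sigma.ι_desc _ _
  have hρ (n : ℕ) : ι (n + 1) ≫ ρ = 0 := Sigma.ι_desc _ _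
  have ext {Z : C} {g g' : T ⟶ Z} (h : ∀ n, ι n ≫ g = ι n ≫ g') : g = g' :=
    Sigma.hom_ext _ _ h
  have hσρ : σ ≫ ρ = 0 := ext fun n => by
    rw [← Category.assoc, hσ]
    rcases n with _ | n
    · simp [hρ₀, hρ, hfr]
    · simp [hρ]
  let S : ShortComplex C := ShortComplex.mk σ ρ hσρ
  have hS : S.Splitting :=
    { r := θ
      s := r.i ≫ ι 0
      f_r := ext fun n => by
        change ι n ≫ σ ≫ θ = ι n ≫ 𝟙 T
        rw [← Category.assoc, hσ]
        rcases n with _ | n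
        · simp only [Preadditive.add_comp, Category.assoc, hθ₀, hθ, Preadditive.comp_add,
            reassoc_of% hff, reassoc_of% hef, reassoc_of% hee, zero_comp, zero_add]
          simp [f]
        · simp only [Preadditive.add_comp, Category.assoc, hθ, Preadditive.comp_add,
            reassoc_of% hff, reassoc_of% hef, reassoc_of% hfe, reassoc_of% hee, zero_comp,
            zero_add, add_zero]
          simp [f]
      s_g := by
        change (r.i ≫ ι 0) ≫ ρ = 𝟙 X
        rw [Category.assoc, hρ₀, r.retract]
      id := ext fun n => by
        change ι n ≫ (θ ≫ σ + ρ ≫ r.i ≫ ι 0) = ι n ≫ 𝟙 T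
        rw [Preadditive.comp_add, ← Category.assoc, ← Category.assoc]
        rcases n with _ | n
        · rw [hθ₀, hρ₀, Category.assoc, hσ]
          simp only [Preadditive.comp_add, reassoc_of% hff, reassoc_of% hfe, zero_comp, add_zero]
          simp [f, e]
        · rw [hθ, hρ, Preadditive.add_comp, Category.assoc, Category.assoc, hσ, hσ]
          simp only [Preadditive.comp_add, reassoc_of% hff, reassoc_of% hfe, reassoc_of% hef,
            reassoc_of% hee, zero_comp, add_zero, zero_add]
          simp [f] }
  exact hP.prop_single_of_shortExact hS.shortExact hT hT

/-- A bounded complex belongs to a localizing subcategory if all its terms do. -/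
theorem prop_Q_of_bounded (n : ℕ) (K : CochainComplex C ℤ) (a : ℤ)
    (hlt : ∀ i < a, IsZero (K.X i)) (hle : ∀ i, a + n ≤ i → IsZero (K.X i))
    (h : ∀ i, P ((singleFunctor C 0).obj (K.X i))) : P (Q.obj K) := by
  induction n generalizing K a with
  | zero =>
    refine hP.prop_of_isZero (Q.map_isZero ?_)
    rw [IsZero.iff_id_eq_zero]
    ext i
    rcases lt_or_ge i a with hi | hi
    · exact (hlt i hi).eq_of_src _ _
    · exact (hle i (by simpa using hi)).eq_of_src _ _
  | succ n ih =>
    -- Split off the lowest term as a quotient; the kernel has one term less.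
    let g : K ⟶ (HomologicalComplex.single C (ComplexShape.up ℤ) a).obj (K.X a) :=
      HomologicalComplex.mkHomToSingle (𝟙 (K.X a)) fun i hi =>
        (hlt i (by simp at hi; lia)).eq_of_src _ _
    have hzero (i : ℤ) (hi : i ≠ a) :
        IsZero (((HomologicalComplex.single C (ComplexShape.up ℤ) a).obj (K.X a)).X i) :=
      HomologicalComplex.isZero_single_obj_X _ _ _ _ hi
    have hga : IsIso (g.f a) := by
      rw [HomologicalComplex.mkHomToSingle_f]
      infer_instance
    have hg : Epi g := HomologicalComplex.epi_of_epi_f _ fun i => by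
      by_cases hi : i = a
      · subst hi
        infer_instance
      · exact ⟨fun _ _ _ => (hzero i hi).eq_of_src _ _⟩
    let S : ShortComplex (CochainComplex C ℤ) := ShortComplex.mk (kernel.ι g) g (by simp)
    have hS : S.ShortExact := { exact := ShortComplex.exact_kernel g }
    have hSi (i : ℤ) := hS.map_of_exact (HomologicalComplex.eval C (ComplexShape.up ℤ) i)
    have hSmono (i : ℤ) : Mono ((kernel.ι g).f i) := (hSi i).mono_f
    have hSa : IsZero ((kernel g).X a) := by
      rw [IsZero.iff_id_eq_zero, ← cancel_mono ((kernel.ι g).f a), ← cancel_mono (g.f a)]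
      simp [← HomologicalComplex.comp_f]
    have hSne (i : ℤ) (hi : i ≠ a) : IsIso ((kernel.ι g).f i) :=
      (hSi i).isIso_f_iff.2 (hzero i hi)
    refine hP.prop_X₂_of_shortExact hS (ih (kernel g) (a + 1) (fun i hi => ?_) (fun i hi => ?_)
      fun i => ?_) (hP.prop_single_of_prop_single_zero (h a) a)
    · rcases (show i ≤ a by lia).eq_or_lt with rfl | hi
      · exact hSa
      · exact IsZero.of_mono ((kernel.ι g).f i) (hlt i hi)
    · exact IsZero.of_mono ((kernel.ι g).f i) (hle i (by push_cast; lia))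
    · by_cases hi : i = a
      · subst hi
        exact hP.prop_single_of_isZero hSa
      · have := hSne i hi
        exact hP.prop_single_of_iso (asIso ((kernel.ι g).f i)).symm (h i)

end IsLocalizing

/-! ### Generation of the derived category of a module category -/

section Telescope

variable {R M : Type*} [Ring R] [AddCommGroup M] [Module R M] (S : ℕ → Submodule R M)

/-- The canonical map from the direct sum of a sequence of submodules of `M` to `M`. -/
noncomputable def telescopeSum : (DirectSum ℕ fun n => S n) →ₗ[R] M :=
  DirectSum.toModule R ℕ M fun n => (S n).subtype

variable (hS : Monotone S)

/-- The endomorphism "identity minus shift" of the direct sum of an increasing sequence of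
submodules of `M`. -/
noncomputable def telescopeShift : (DirectSum ℕ fun n => S n) →ₗ[R] DirectSum ℕ fun n => S n :=
  DirectSum.toModule R ℕ _ fun n =>
    DirectSum.lof R ℕ (fun n => S n) n -
      DirectSum.lof R ℕ (fun n => S n) (n + 1) ∘ₗ Submodule.inclusion (hS n.le_succ)

@[simp]
theorem telescopeSum_lof (n : ℕ) (x : S n) :
    telescopeSum S (DirectSum.lof R ℕ (fun n => S n) n x) = x := by
  simp [telescopeSum]

@[simp]
theorem telescopeShift_lof (n : ℕ) (x : S n) :
    telescopeShift S hS (DirectSum.lof R ℕ (fun n => S n) n x) =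
      DirectSum.lof R ℕ (fun n => S n) n x -
      DirectSum.lof R ℕ (fun n => S n) (n + 1) (Submodule.inclusion (hS n.le_succ) x) := by
  simp [telescopeShift]

theorem telescopeSum_comp_telescopeShift : telescopeSum S ∘ₗ telescopeShift S hS = 0 := by
  ext n x
  simp

theorem telescopeShift_apply_zero (x : DirectSum ℕ fun n => S n) :
    (telescopeShift S hS x) 0 = x 0 := by
  induction x using DirectSum.induction_on with
  | zero => simp
  | add x y hx hy => simp [map_add, hx, hy]
  | of n x =>
    change (telescopeShift S hS (DirectSum.lof R ℕ (fun n => S n) n x)) 0 = _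
    rw [telescopeShift_lof, DirectSum.sub_apply]
    simp only [DirectSum.lof_eq_of]
    rw [DirectSum.of_eq_of_ne (n + 1) 0 _ (by simp), sub_zero]

theorem telescopeShift_apply_succ (x : DirectSum ℕ fun n => S n) (m : ℕ) :
    ((telescopeShift S hS x) (m + 1) : M) = x (m + 1) - x m := by
  induction x using DirectSum.induction_on with
  | zero => simp
  | add x y hx hy => simp only [map_add, DirectSum.add_apply, Submodule.coe_add, hx, hy]; abel
  | of n x =>
    change ((telescopeShift S hS (DirectSum.lof R ℕ (fun n => S n) n x)) (m + 1) : M) = _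
    rw [telescopeShift_lof, DirectSum.sub_apply]
    simp only [DirectSum.lof_eq_of, Submodule.coe_sub]
    congr 1
    by_cases h : m = n
    · subst h
      simp
    · rw [DirectSum.of_eq_of_ne (n + 1) (m + 1) _ (by simpa using h),
        DirectSum.of_eq_of_ne n m _ h]
      rfl

theorem telescopeShift_injective : Function.Injective (telescopeShift S hS) := by
  rw [injective_iff_map_eq_zero]
  intro x hx
  have h (n : ℕ) : x n = 0 := by
    induction n with
    | zero => rw [← telescopeShift_apply_zero S hS, hx, DirectSum.zero_apply]
    | succ n ih =>
      have := telescopeShift_apply_succ S hS x n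
      rw [hx, ih] at this
      simpa using this.symm
  exact DFinsupp.ext h

theorem telescopeSum_surjective (hS' : ∀ x, ∃ n, x ∈ S n) :
    Function.Surjective (telescopeSum S) := fun x => by
  obtain ⟨n, hn⟩ := hS' x
  exact ⟨DirectSum.lof R ℕ (fun n => S n) n ⟨x, hn⟩, by simp⟩

/-- Modulo the image of "identity minus shift", every element of the direct sum is equivalent to
its sum, placed in a sufficiently late summand. -/
theorem exists_sub_lof_mem_range_telescopeShift (x : DirectSum ℕ fun n => S n) :
    ∃ N, ∀ m, N ≤ m → ∃ y : S m, (y : M) = telescopeSum S x ∧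
      x - DirectSum.lof R ℕ (fun n => S n) m y ∈ LinearMap.range (telescopeShift S hS) := by
  induction x using DirectSum.induction_on with
  | zero => exact ⟨0, fun m _ => ⟨0, by simp, by simp⟩⟩
  | add x y hx hy =>
    obtain ⟨N₁, h₁⟩ := hx
    obtain ⟨N₂, h₂⟩ := hy
    refine ⟨max N₁ N₂, fun m hm => ?_⟩
    obtain ⟨x', hx, hx'⟩ := h₁ m (le_trans (le_max_left _ _) hm)
    obtain ⟨y', hy, hy'⟩ := h₂ m (le_trans (le_max_right _ _) hm)
    refine ⟨x' + y', by simp [hx, hy], ?_⟩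
    rw [map_add, add_sub_add_comm]
    exact add_mem hx' hy'
  | of n x =>
    refine ⟨n, fun m hm => ⟨Submodule.inclusion (hS hm) x, (telescopeSum_lof S n x).symm, ?_⟩⟩
    change DirectSum.lof R ℕ (fun n => S n) n x - _ ∈ _
    induction m, hm using Nat.le_induction with
    | base =>
      have := zero_mem (LinearMap.range (telescopeShift S hS))
      rwa [← sub_self (DirectSum.lof R ℕ (fun n => S n) n x)] at this
    | succ m hm ih =>
      have := add_mem ih (LinearMap.mem_range_self (telescopeShift S hS)
        (DirectSum.lof R ℕ (fun n => S n) m (Submodule.inclusion (hS hm) x)))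
      rw [telescopeShift_lof, sub_add_sub_cancel] at this
      exact this

theorem telescope_exact : Function.Exact (telescopeShift S hS) (telescopeSum S) := by
  refine LinearMap.exact_iff.2 (le_antisymm (fun x hx => ?_) ?_)
  · obtain ⟨N, h⟩ := exists_sub_lof_mem_range_telescopeShift S hS x
    obtain ⟨y, hy, h⟩ := h N le_rfl
    have : y = 0 := Subtype.ext (hy.trans hx)
    rwa [this, map_zero, sub_zero] at h
  · exact LinearMap.range_le_ker_iff.2 (telescopeSum_comp_telescopeShift S hS)

end Telescope

namespace CochainComplex

variable {R : Type u} [Ring R]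

section DirectSum

variable (K : ℕ → CochainComplex (ModuleCat.{u} R) ℤ)

/-- The direct sum of a sequence of complexes of modules. -/
noncomputable def directSum : CochainComplex (ModuleCat.{u} R) ℤ where
  X i := ModuleCat.of R (DirectSum ℕ fun n => (K n).X i)
  d i j := ModuleCat.ofHom (DirectSum.lmap fun n => ((K n).d i j).hom)
  shape i j hij := by
    refine ModuleCat.hom_ext (LinearMap.ext fun x => DFinsupp.ext fun n => ?_)
    change ((K n).d i j).hom _ = _
    rw [(K n).shape i j hij]
    rfl
  d_comp_d' i j k _ _ := by
    refine ModuleCat.hom_ext (LinearMap.ext fun x => DFinsupp.ext fun n => ?_)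
    change ((K n).d j k).hom (((K n).d i j).hom _) = _
    rw [← ModuleCat.comp_apply, (K n).d_comp_d]
    rfl

/-- The inclusion of a summand. -/
noncomputable def directSumι (n : ℕ) : K n ⟶ directSum K where
  f i := ModuleCat.ofHom (DirectSum.lof R ℕ (fun n => (K n).X i) n)
  comm' i j _ := by
    ext x
    exact DirectSum.lmap_lof (R := R) (fun n => ((K n).d i j).hom) n x

variable {K} in
/-- The morphism out of a direct sum of complexes given by morphisms out of the summands. -/
noncomputable def directSumDesc {L : CochainComplex (ModuleCat.{u} R) ℤ} (f : ∀ n, K n ⟶ L) :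
    directSum K ⟶ L where
  f i := ModuleCat.ofHom (DirectSum.toModule R ℕ _ fun n => ((f n).f i).hom)
  comm' i j _ := by
    refine ModuleCat.hom_ext (DirectSum.linearMap_ext _ fun n => LinearMap.ext fun x => ?_)
    have := ConcreteCategory.congr_hom ((f n).comm i j) x
    change (L.d i j).hom (DirectSum.toModule R ℕ _ (fun n => ((f n).f i).hom)
        (DirectSum.lof R ℕ _ n x)) =
      DirectSum.toModule R ℕ _ (fun n => ((f n).f j).hom)
        (DirectSum.lmap (fun n => ((K n).d i j).hom) (DirectSum.lof R ℕ _ n x))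
    rw [DirectSum.toModule_lof, DirectSum.lmap_lof, DirectSum.toModule_lof]
    exact this

variable {K} in
theorem directSumDesc_f_lof {L : CochainComplex (ModuleCat.{u} R) ℤ} (f : ∀ n, K n ⟶ L) (i : ℤ)
    (n : ℕ) (x : (K n).X i) :
    ((directSumDesc f).f i).hom (DirectSum.lof R ℕ (fun n => (K n).X i) n x) = (f n).f i x :=
  DirectSum.toModule_lof _ _ _

variable {K} in
theorem directSum_hom_ext {L : CochainComplex (ModuleCat.{u} R) ℤ} {f g : directSum K ⟶ L}
    (h : ∀ n, directSumι K n ≫ f = directSumι K n ≫ g) : f = g := by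
  ext i : 1
  refine ModuleCat.hom_ext (DirectSum.linearMap_ext _ fun n => ?_)
  exact congr_arg (fun φ : K n ⟶ L => (φ.f i).hom) (h n)

variable {K} in
theorem directSumι_desc {L : CochainComplex (ModuleCat.{u} R) ℤ} (f : ∀ n, K n ⟶ L) (n : ℕ) :
    directSumι K n ≫ directSumDesc f = f n := by
  ext i x
  exact directSumDesc_f_lof f i n x

/-- The direct sum of complexes of modules is their coproduct. -/
noncomputable def directSumIsColimit :
    IsColimit (Cofan.mk (directSum K) (directSumι K)) :=
  Cofan.IsColimit.mk _ (fun s => directSumDesc s.inj) (fun s n => directSumι_desc s.inj n)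
    fun s _ hm => directSum_hom_ext fun n => (hm n).trans (directSumι_desc s.inj n).symm

end DirectSum

section Submodules

variable (K : CochainComplex (ModuleCat.{u} R) ℤ)

/-- The subcomplex of a complex of modules given by submodules which are preserved by the
differential. -/
def submodules (S : ∀ i, Submodule R (K.X i))
    (hS : ∀ i j, S i ≤ (S j).comap (K.d i j).hom) : CochainComplex (ModuleCat.{u} R) ℤ where
  X i := ModuleCat.of R (S i)
  d i j := ModuleCat.ofHom ((K.d i j).hom.restrict (hS i j))
  shape i j hij := by
    refine ModuleCat.hom_ext (LinearMap.ext fun x => Subtype.ext ?_)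
    change (K.d i j).hom x = 0
    rw [K.shape i j hij]
    rfl
  d_comp_d' i j k _ _ := by
    refine ModuleCat.hom_ext (LinearMap.ext fun x => Subtype.ext ?_)
    change (K.d j k).hom ((K.d i j).hom x) = 0
    rw [← ModuleCat.comp_apply, K.d_comp_d]
    rfl

variable {K} (S : ℕ → ∀ i, Submodule R (K.X i))
  (hS : ∀ n i j, S n i ≤ (S n j).comap (K.d i j).hom)

/-- The inclusion of a subcomplex. -/
def submodulesι (n : ℕ) : K.submodules (S n) (hS n) ⟶ K where
  f i := ModuleCat.ofHom (S n i).subtype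

/-- The transition maps of an increasing sequence of subcomplexes. -/
def submodulesMap (hmono : ∀ n i, S n i ≤ S (n + 1) i) (n : ℕ) :
    K.submodules (S n) (hS n) ⟶ K.submodules (S (n + 1)) (hS (n + 1)) where
  f i := ModuleCat.ofHom (Submodule.inclusion (hmono n i))

/-- A complex of modules belongs to a localizing subcategory if it is the union of an increasing
sequence of subcomplexes which do: it is the cokernel of the injection "identity minus shift" of
their direct sum. -/
theorem _root_.IsLocalizing.prop_Q_of_submodules [HasDerivedCategory.{w} (ModuleCat.{u} R)]
    {P : ObjectProperty (DerivedCategory (ModuleCat.{u} R))} (hP : IsLocalizing.{u} P)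
    (hmono : ∀ n i, S n i ≤ S (n + 1) i) (hex : ∀ i x, ∃ n, x ∈ S n i)
    (h : ∀ n, P (DerivedCategory.Q.obj (K.submodules (S n) (hS n)))) :
    P (DerivedCategory.Q.obj K) := by
  have := hP.coproducts_nat
  let T := directSum fun n => K.submodules (S n) (hS n)
  have hT : P (DerivedCategory.Q.obj T) :=
    P.prop_of_isColimit (isColimitOfPreserves DerivedCategory.Q (directSumIsColimit _))
      fun ⟨n⟩ => h n
  let σ : T ⟶ T := directSumDesc fun n =>
    directSumι (fun n => K.submodules (S n) (hS n)) n -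
      submodulesMap S hS hmono n ≫ directSumι (fun n => K.submodules (S n) (hS n)) (n + 1)
  let ρ : T ⟶ K := directSumDesc (submodulesι S hS)
  have hm (i : ℤ) : Monotone fun n => S n i := monotone_nat_of_le_succ fun n => hmono n i
  have hσ (i : ℤ) : (σ.f i).hom = telescopeShift (fun n => S n i) (hm i) := rfl
  have hρ (i : ℤ) : (ρ.f i).hom = telescopeSum fun n => S n i := rfl
  have hz : σ ≫ ρ = 0 := by
    ext i : 1
    exact ModuleCat.hom_ext (telescopeSum_comp_telescopeShift _ (hm i))
  refine hP.prop_X₃_of_shortExact (S := ShortComplex.mk σ ρ hz) ?_ hT hT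
  refine HomologicalComplex.shortExact_of_degreewise_shortExact _ fun i => ?_
  refine ModuleCat.shortComplex_shortExact _ ?_ ?_ ?_
  · exact telescope_exact _ (hm i)
  · exact telescopeShift_injective _ (hm i)
  · exact telescopeSum_surjective _ (hex i)

end Submodules

end CochainComplex

namespace CochainComplex

variable {R : Type u} [Ring R] (K : CochainComplex (ModuleCat.{u} R) ℤ)

/-- The terms of the subcomplex of `K` which agrees with `K` in the degrees from `-n` to `n - 1`,
consists of the cycles in degree `n`, and vanishes in all other degrees. -/
noncomputable def boundedTrunc (n : ℕ) (i : ℤ) : Submodule R (K.X i) :=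
  if -n ≤ i ∧ i < n then ⊤ else if i = n then LinearMap.ker (K.d i (i + 1)).hom else ⊥

theorem boundedTrunc_le_comap (n : ℕ) (i j : ℤ) :
    K.boundedTrunc n i ≤ (K.boundedTrunc n j).comap (K.d i j).hom := by
  intro x hx
  rw [Submodule.mem_comap]
  by_cases hij : i + 1 = j
  · subst hij
    simp only [boundedTrunc] at hx ⊢
    have hdd : (K.d (i + 1) (i + 1 + 1)).hom ((K.d i (i + 1)).hom x) = 0 := by
      rw [← ModuleCat.comp_apply, K.d_comp_d]
      rfl
    split_ifs at hx with h₁ h₂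
    · split_ifs with h₃ h₄
      · trivial
      · exact hdd
      · lia
    · rw [LinearMap.mem_ker] at hx
      rw [hx]
      exact zero_mem _
    · rw [Submodule.mem_bot] at hx
      rw [hx, map_zero]
      exact zero_mem _
  · rw [K.shape i j hij]
    exact zero_mem _

theorem boundedTrunc_le_succ (n : ℕ) (i : ℤ) : K.boundedTrunc n i ≤ K.boundedTrunc (n + 1) i := by
  unfold boundedTrunc
  split_ifs <;> first | exact le_rfl | exact le_top | exact bot_le | (exfalso; push_cast at *; lia)

theorem exists_mem_boundedTrunc (i : ℤ) (x : K.X i) : ∃ n, x ∈ K.boundedTrunc n i := by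
  refine ⟨i.natAbs + 1, ?_⟩
  rw [boundedTrunc, if_pos (by omega)]
  trivial

end CochainComplex

namespace IsLocalizing

open DerivedCategory

variable {R : Type u} [Ring R] [HasDerivedCategory.{w} (ModuleCat.{u} R)]
  {P : ObjectProperty (DerivedCategory (ModuleCat.{u} R))} (hP : IsLocalizing.{u} P)

include hP

/-- A complex of modules belongs to a localizing subcategory if its terms and its modules of cycles
in non-negative degrees do. -/
theorem prop_Q_of_terms (K : CochainComplex (ModuleCat.{u} R) ℤ)
    (h : ∀ i, P ((singleFunctor _ 0).obj (K.X i)))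
    (hker : ∀ n : ℕ, P ((singleFunctor _ 0).obj
      (ModuleCat.of R (LinearMap.ker (K.d n (n + 1)).hom)))) : P (Q.obj K) := by
  refine hP.prop_Q_of_submodules K.boundedTrunc K.boundedTrunc_le_comap K.boundedTrunc_le_succ
    K.exists_mem_boundedTrunc fun n => ?_
  have hbot (i : ℤ) (hi : K.boundedTrunc n i = ⊥) :
      IsZero (ModuleCat.of R (K.boundedTrunc n i)) := by
    rw [hi]
    exact ModuleCat.isZero_of_subsingleton _
  refine hP.prop_Q_of_bounded (2 * n + 1) _ (-n) (fun i hi => hbot i ?_) (fun i hi => hbot i ?_)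
    fun i => ?_
  · rw [CochainComplex.boundedTrunc, if_neg (by lia), if_neg (by lia)]
  · rw [CochainComplex.boundedTrunc, if_neg (by push_cast at hi; lia),
      if_neg (by push_cast at hi; lia)]
  · change P ((singleFunctor _ 0).obj (ModuleCat.of R (K.boundedTrunc n i)))
    by_cases h₁ : -n ≤ i ∧ i < n
    · rw [CochainComplex.boundedTrunc, if_pos h₁]
      exact hP.prop_single_of_iso (Submodule.topEquiv (R := R) (M := K.X i)).symm.toModuleIso (h i)
    · by_cases h₂ : i = n
      · subst h₂
        rw [CochainComplex.boundedTrunc, if_neg h₁, if_pos rfl]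
        exact hker n
      · refine hP.prop_single_of_isZero (hbot i ?_)
        rw [CochainComplex.boundedTrunc, if_neg h₁, if_neg h₂]

theorem prop_single_of_projective (hR : P ((singleFunctor _ 0).obj (ModuleCat.of R R)))
    (M : ModuleCat.{u} R) [Projective M] : P ((singleFunctor _ 0).obj M) := by
  classical
  have := hP.coproducts M
  have : Module.Projective R M := (IsProjective.iff_projective M).2 inferInstance
  obtain ⟨s, hs⟩ := Module.projective_def'.1 this
  have hfree : P ((singleFunctor _ 0).obj (ModuleCat.of R (M →₀ R))) :=
    hP.prop_single_of_iso (finsuppLEquivDirectSum R R M).symm.toModuleIso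
      (prop_single_of_isColimit P
        (ModuleCat.coproductCoconeIsColimit fun _ : M => ModuleCat.of R R) fun _ => hR)
  exact hP.prop_single_of_retract
    { i := ModuleCat.ofHom s
      r := ModuleCat.ofHom (Finsupp.linearCombination R id)
      retract := ModuleCat.hom_ext hs } hfree

/-- The regular module generates the derived category of a ring: modules are reached through
projective resolutions, and complexes through bounded subcomplexes. -/
theorem eq_top_of_prop_single_self (hR : P ((singleFunctor _ 0).obj (ModuleCat.of R R))) :
    P = ⊤ := by
  have hmod (M : ModuleCat.{u} R) : P ((singleFunctor _ 0).obj M) := by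
    let F := projectiveResolution M
    have : IsIso (Q.map F.π') := (isIso_Q_map_iff_quasiIso _ _).2 inferInstance
    let e : Q.obj F.cochainComplex ≅ Q.obj ((CochainComplex.singleFunctor _ 0).obj M) :=
      asIso (Q.map F.π')
    refine hP.prop_of_iso e (hP.prop_Q_of_terms _
      (fun i => hP.prop_single_of_projective hR _) fun n => ?_)
    have hd : F.cochainComplex.d n (n + 1) = 0 :=
      (F.cochainComplex.isZero_of_isStrictlyLE 0 _ (by lia)).eq_of_tgt _ _
    rw [hd, ModuleCat.hom_zero, LinearMap.ker_zero]
    exact hP.prop_single_of_iso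
      (Submodule.topEquiv (R := R) (M := F.cochainComplex.X n)).symm.toModuleIso
      (hP.prop_single_of_projective hR (F.cochainComplex.X n))
  ext X
  refine ⟨fun _ => trivial, fun _ => ?_⟩
  exact hP.prop_of_iso (Q.objObjPreimageIso X)
    (hP.prop_Q_of_terms _ (fun i => hmod _) fun n => hmod _)

end IsLocalizing

/-! ### Change of rings along matrix representations -/

section MatrixRestrict

variable {R L : Type u} [Ring R] [Ring L] {ι : Type} [Fintype ι] [DecidableEq ι]

/-- The functor from `R`-modules to `L`-modules which sends `M` to `ι → M`, on which `L` acts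
through a ring homomorphism to the ring of matrices over `R`. -/
noncomputable def matrixRestrict (ρ : L →+* Matrix ι ι R) : ModuleCat.{u} R ⥤ ModuleCat.{u} L :=
  ModuleCat.toMatrixModCat R ι ⋙ ModuleCat.restrictScalars ρ

variable (ρ : L →+* Matrix ι ι R)

instance [Nonempty ι] : (ModuleCat.toMatrixModCat.{u} R ι).IsEquivalence :=
  (ModuleCat.matrixEquivalence R (Classical.arbitrary ι)).isEquivalence_functor

instance : (matrixRestrict ρ).Additive where

instance [Nonempty ι] : PreservesFiniteLimits (matrixRestrict ρ) :=
  have : PreservesFiniteLimits (ModuleCat.restrictScalars.{u} ρ) :=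
    ⟨fun _ _ _ => ⟨inferInstance⟩⟩
  comp_preservesFiniteLimits _ _

instance [Nonempty ι] : PreservesFiniteColimits (matrixRestrict ρ) :=
  comp_preservesFiniteColimits _ _

instance [Nonempty ι] (J : Type u) : PreservesColimitsOfShape (Discrete J) (matrixRestrict ρ) :=
  comp_preservesColimitsOfShape _ _

/-- If injectives generate the derived category of `R`, then a localizing subcategory of the derived
category of `L` contains the images of all `R`-modules under `matrixRestrict` as soon as it contains
the images of the injective ones. -/
theorem IsLocalizing.prop_single_matrixRestrict [Nonempty ι]
    [HasDerivedCategory.{v} (ModuleCat.{u} R)] [HasDerivedCategory.{w} (ModuleCat.{u} L)]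
    (hR : Loc.{u} (injectivesInDegreeZero (ModuleCat.{u} R)) = ⊤)
    {P : ObjectProperty (DerivedCategory (ModuleCat.{u} L))} (hP : IsLocalizing.{u} P)
    (h : ∀ I : ModuleCat.{u} R, Injective I →
      P ((DerivedCategory.singleFunctor _ 0).obj ((matrixRestrict ρ).obj I)))
    (M : ModuleCat.{u} R) :
    P ((DerivedCategory.singleFunctor _ 0).obj ((matrixRestrict ρ).obj M)) := by
  have hQ : IsLocalizing.{u} (P.inverseImage (matrixRestrict ρ).mapDerivedCategory) :=
    hP.inverseImage _ fun _ => Functor.preservesCoproducts_mapDerivedCategory _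
  have e (M : ModuleCat.{u} R) := ((matrixRestrict ρ).mapDerivedCategorySingleFunctor 0).app M
  have hM : Loc.{u} (injectivesInDegreeZero (ModuleCat.{u} R))
      ((DerivedCategory.singleFunctor _ 0).obj M) := by
    rw [hR]
    trivial
  refine hP.prop_of_iso (e M) (hM _ hQ ?_)
  rintro X ⟨I, hI, ⟨f⟩⟩
  exact hQ.prop_of_iso f.symm (hP.prop_of_iso (e I).symm (h I hI))

/-- An isomorphism from a module of the form `matrixRestrict` is an additive bijection from the
functions `ι → M` which is compatible with the action by matrices. -/
noncomputable def matrixRestrictIso (M : ModuleCat.{u} R) (N : ModuleCat.{u} L) (T : (ι → M) →+ N)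
    (hT : Function.Bijective T)
    (h : ∀ (l : L) (v : ι → M), T (fun i => ∑ j, ρ l i j • v j) = l • T v) :
    (matrixRestrict ρ).obj M ≅ N :=
  LinearEquiv.toModuleIso (X₁ := (matrixRestrict ρ).obj M) <|
    LinearEquiv.ofBijective (M := (matrixRestrict ρ).obj M)
      { toFun := T
        map_add' := T.map_add
        map_smul' := h } hT

end MatrixRestrict

section Coextension

variable {R L : Type u} [Ring R] [Ring L] (α : R →+* L) (M : ModuleCat.{u} R)

/-- The element of the coextension of scalars of `M` given by an `R`-linear map `L → M`. -/
noncomputable def ModuleCat.CoextendScalars.mk (g : L →+ M) (hg : ∀ r x, g (α r * x) = r • g x) :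
    (ModuleCat.coextendScalars.{u, u, u} α).obj M :=
  (ModuleCat.CoextendScalars.equiv α M).symm
    (show (ModuleCat.restrictScalars.{u} α).obj (ModuleCat.of L L) →ₗ[R] M from
      { toFun := g
        map_add' := g.map_add
        map_smul' := hg })

variable {α M}

variable (f : (ModuleCat.coextendScalars.{u, u, u} α).obj M)

theorem ModuleCat.CoextendScalars.ext_apply {f g : (ModuleCat.coextendScalars.{u, u, u} α).obj M}
    (h : ∀ x : L, f x = g x) : f = g :=
  ModuleCat.CoextendScalars.ext (LinearMap.ext h)

theorem ModuleCat.CoextendScalars.apply_add (x y : L) : f (x + y) = f x + f y :=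
  (ModuleCat.CoextendScalars.equiv α M f).map_add x y

theorem ModuleCat.CoextendScalars.apply_mul (r : R) (x : L) : f (α r * x) = r • f x :=
  (ModuleCat.CoextendScalars.equiv α M f).map_smul r x

theorem ModuleCat.CoextendScalars.apply_sum {ι : Type*} (s : Finset ι) (x : ι → L) :
    f (∑ i ∈ s, x i) = ∑ i ∈ s, f (x i) :=
  map_sum (ModuleCat.CoextendScalars.equiv α M f) x s

end Coextension

section Representations

variable {R L : Type u} [Ring R] [Ring L] {ι : Type} [Fintype ι]

/-- The coordinates with respect to a finite basis `e` of `L` as a right module over `R`. -/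
noncomputable def rightCoord {β : R →+* L} {e : ι → L}
    (h : Function.Bijective fun f : ι → R => ∑ i, e i * β (f i)) (x : L) : ι → R :=
  (Equiv.ofBijective _ h).symm x

section Right

variable {β : R →+* L} {e : ι → L} (h : Function.Bijective fun f : ι → R => ∑ i, e i * β (f i))

theorem sum_rightCoord (x : L) : ∑ i, e i * β (rightCoord h x i) = x :=
  (Equiv.ofBijective _ h).apply_symm_apply x

theorem rightCoord_eq {x : L} {f : ι → R} (hf : ∑ i, e i * β (f i) = x) : rightCoord h x = f :=
  h.1 ((sum_rightCoord h x).trans hf.symm)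

variable [DecidableEq ι]

/-- The representation of `L` by matrices over `R` given by left multiplication on `L`, with respect
to a finite basis `e` of `L` as a right `R`-module. -/
noncomputable def rightRep : L →+* Matrix ι ι R where
  toFun l := Matrix.of fun i j => rightCoord h (l * e j) i
  map_one' := by
    ext i j
    rw [Matrix.of_apply, rightCoord_eq h (f := fun i => (1 : Matrix ι ι R) i j)]
    simp [Matrix.one_apply]
  map_zero' := by
    ext i j
    rw [Matrix.of_apply, rightCoord_eq h (f := fun _ => 0) (by simp)]
    rfl
  map_add' x y := by
    ext i j
    rw [Matrix.of_apply,
      rightCoord_eq h (f := fun i => rightCoord h (x * e j) i + rightCoord h (y * e j) i)]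
    · rfl
    · simp_rw [map_add, mul_add, Finset.sum_add_distrib, sum_rightCoord, add_mul]
  map_mul' x y := by
    ext i j
    rw [Matrix.of_apply, rightCoord_eq h
      (f := fun i => ∑ m, rightCoord h (x * e m) i * rightCoord h (y * e j) m)]
    · rfl
    · simp_rw [map_sum, map_mul, Finset.mul_sum, ← mul_assoc]
      rw [Finset.sum_comm]
      simp_rw [← Finset.sum_mul, sum_rightCoord, mul_assoc, ← Finset.mul_sum, sum_rightCoord]

theorem sum_mul_rightRep (l : L) (j : ι) : ∑ i, e i * β (rightRep h l i j) = l * e j :=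
  sum_rightCoord h _

/-- If `L` is free as a right `R`-module, then `matrixRestrict` of the corresponding representation
is extension of scalars; in particular, it sends the regular `R`-module to the regular
`L`-module. -/
noncomputable def matrixRestrictRightRepSelfIso :
    (matrixRestrict (rightRep h)).obj (ModuleCat.of R R) ≅ ModuleCat.of L L :=
  matrixRestrictIso _ (ModuleCat.of R R) (ModuleCat.of L L)
    { toFun := fun f : ι → R => ∑ i, e i * β (f i)
      map_zero' := by simp
      map_add' := fun f g => by
        simp_rw [Pi.add_apply, map_add, mul_add, Finset.sum_add_distrib] } h fun l f => by
    change ∑ i, e i * β (∑ j, rightRep h l i j * (show ι → R from f) j) =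
      l * ∑ i, e i * β ((show ι → R from f) i)
    simp_rw [map_sum, map_mul, Finset.mul_sum, ← mul_assoc]
    rw [Finset.sum_comm]
    simp_rw [← Finset.sum_mul, sum_mul_rightRep]

end Right

/-- The coordinates with respect to a finite basis `e` of `L` as a left module over `R`. -/
noncomputable def leftCoord {α : R →+* L} {e : ι → L}
    (h : Function.Bijective fun f : ι → R => ∑ i, α (f i) * e i) (x : L) : ι → R :=
  (Equiv.ofBijective _ h).symm x

section Left

variable {α : R →+* L} {e : ι → L} (h : Function.Bijective fun f : ι → R => ∑ i, α (f i) * e i)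

theorem sum_leftCoord (x : L) : ∑ i, α (leftCoord h x i) * e i = x :=
  (Equiv.ofBijective _ h).apply_symm_apply x

theorem leftCoord_eq {x : L} {f : ι → R} (hf : ∑ i, α (f i) * e i = x) : leftCoord h x = f :=
  h.1 ((sum_leftCoord h x).trans hf.symm)

theorem leftCoord_add (x y : L) : leftCoord h (x + y) = leftCoord h x + leftCoord h y :=
  leftCoord_eq h (by simp [add_mul, Finset.sum_add_distrib, sum_leftCoord])

theorem leftCoord_mul (r : R) (x : L) (i : ι) :
    leftCoord h (α r * x) i = r * leftCoord h x i :=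
  congr_fun (leftCoord_eq h (f := fun i => r * leftCoord h x i)
    (by simp_rw [map_mul, mul_assoc, ← Finset.mul_sum, sum_leftCoord])) i

theorem leftCoord_self [DecidableEq ι] (i : ι) : leftCoord h (e i) = Pi.single i 1 :=
  leftCoord_eq h (by simp [Pi.single_apply])

/-- The homomorphism of left `R`-modules `L → M` with given values on the basis. -/
noncomputable def leftCoextend (M : ModuleCat.{u} R) :
    (ι → M) →+ (ModuleCat.coextendScalars.{u, u, u} α).obj M where
  toFun v := ModuleCat.CoextendScalars.mk α M
    { toFun := fun x => ∑ j, leftCoord h x j • v j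
      map_zero' := by
        have : leftCoord h 0 = 0 := leftCoord_eq h (by simp)
        simp [this]
      map_add' := fun x y => by
        simp_rw [leftCoord_add, Pi.add_apply, add_smul, Finset.sum_add_distrib] }
    fun r x => by
      change ∑ j, leftCoord h (α r * x) j • v j = r • ∑ j, leftCoord h x j • v j
      simp_rw [leftCoord_mul, Finset.smul_sum, smul_smul]
  map_zero' := ModuleCat.CoextendScalars.ext_apply fun x =>
    Finset.sum_eq_zero fun j _ => smul_zero _
  map_add' v w := ModuleCat.CoextendScalars.ext_apply fun x => by
    refine (Finset.sum_congr rfl fun j _ => smul_add _ _ _).trans ?_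
    exact Finset.sum_add_distrib

theorem leftCoextend_apply (M : ModuleCat.{u} R) (v : ι → M) (x : L) :
    leftCoextend h M v x = ∑ j, leftCoord h x j • v j := rfl

theorem leftCoextend_bijective (M : ModuleCat.{u} R) :
    Function.Bijective (leftCoextend h M) := by
  classical
  refine ⟨fun v w hvw => funext fun i => ?_, fun f => ⟨fun j => f (e j), ?_⟩⟩
  · have (v : ι → M) : leftCoextend h M v (e i) = v i := by
      simp [leftCoextend_apply, leftCoord_self, Pi.single_apply]
    rw [← this v, hvw, this]
  · refine ModuleCat.CoextendScalars.ext_apply fun x => ?_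
    refine .trans ?_ (congr_arg (fun y : L => f y) (sum_leftCoord h x))
    refine .trans ?_ (ModuleCat.CoextendScalars.apply_sum f _ _).symm
    exact Finset.sum_congr rfl fun j _ => (ModuleCat.CoextendScalars.apply_mul f _ _).symm

variable [DecidableEq ι]

/-- The representation of `L` by matrices over `R` given by right multiplication on `L`, with
respect to a finite basis `e` of `L` as a left `R`-module. -/
noncomputable def leftRep : L →+* Matrix ι ι R where
  toFun l := Matrix.of fun i j => leftCoord h (e i * l) j
  map_one' := by
    ext i j
    rw [Matrix.of_apply, mul_one, leftCoord_self, Matrix.one_apply, Pi.single_apply]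
    simp only [eq_comm]
  map_zero' := by
    ext i j
    rw [Matrix.of_apply, leftCoord_eq h (f := fun _ => 0) (by simp)]
    rfl
  map_add' x y := by
    ext i j
    rw [Matrix.of_apply, mul_add, leftCoord_add]
    rfl
  map_mul' x y := by
    ext i j
    rw [Matrix.of_apply, leftCoord_eq h
      (f := fun j => ∑ m, leftCoord h (e i * x) m * leftCoord h (e m * y) j)]
    · rfl
    · simp_rw [map_sum, map_mul, Finset.sum_mul, mul_assoc]
      rw [Finset.sum_comm]
      simp_rw [← Finset.mul_sum, sum_leftCoord, ← mul_assoc, ← Finset.sum_mul, sum_leftCoord]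

theorem sum_leftRep_mul (l : L) (i : ι) : ∑ j, α (leftRep h l i j) * e j = e i * l :=
  sum_leftCoord h _

/-- If `L` is free as a left `R`-module, then `matrixRestrict` of the corresponding representation
is coextension of scalars: a homomorphism of left `R`-modules from `L` is given by its values on the
basis. -/
noncomputable def matrixRestrictLeftRepIso (M : ModuleCat.{u} R) :
    (matrixRestrict (leftRep h)).obj M ≅ (ModuleCat.coextendScalars.{u, u, u} α).obj M :=
  matrixRestrictIso _ M _ (leftCoextend h M) (leftCoextend_bijective h M) fun l v => by
    refine ModuleCat.CoextendScalars.ext_apply fun x => ?_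
    change ∑ j, leftCoord h x j • ∑ m, leftRep h l j m • v m = ∑ j, leftCoord h (x * l) j • v j
    have key (j : ι) : leftCoord h (x * l) j = ∑ i, leftCoord h x i * leftRep h l i j := by
      refine congr_fun (leftCoord_eq h
        (f := fun j => ∑ i, leftCoord h x i * leftRep h l i j) ?_) j
      simp_rw [map_sum, map_mul, Finset.sum_mul, mul_assoc]
      rw [Finset.sum_comm]
      simp_rw [← Finset.mul_sum, sum_leftRep_mul, ← mul_assoc, ← Finset.sum_mul, sum_leftCoord]
    simp_rw [key, Finset.smul_sum, Finset.sum_smul, smul_smul]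
    exact Finset.sum_comm

end Left

end Representations

/-! ### Algebras which factor as a twisted product of two subalgebras -/

section TensorBasis

variable {k A V : Type*} [Field k] [AddCommGroup A] [Module k A] [AddCommGroup V] [Module k V]
  {ι : Type*} [Fintype ι]

theorem Module.Basis.bijective_sum_tmul_left (a : Module.Basis ι k A) :
    Function.Bijective fun f : ι → V => ∑ i, a i ⊗ₜ[k] f i := by
  classical
  convert ((Finsupp.linearEquivFunOnFinite k V ι).symm.trans
    (TensorProduct.equivFinsuppOfBasisLeft a).symm).bijective using 2 with f
  simp [TensorProduct.equivFinsuppOfBasisLeft_symm_apply, Finsupp.sum_fintype]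

theorem Module.Basis.bijective_sum_tmul_right (a : Module.Basis ι k A) :
    Function.Bijective fun f : ι → V => ∑ i, f i ⊗ₜ[k] a i := by
  classical
  convert ((Finsupp.linearEquivFunOnFinite k V ι).symm.trans
    (TensorProduct.equivFinsuppOfBasisRight a).symm).bijective using 2 with f
  simp [TensorProduct.equivFinsuppOfBasisRight_symm_apply, Finsupp.sum_fintype]

end TensorBasis

section Factorization

variable {k A B L : Type u} [Field k] [Ring A] [Algebra k A] [Ring B] [Algebra k B]
  [Ring L] [Algebra k L]

/-- The linear map `A ⊗ B → L`, `x ⊗ y ↦ α x * β y`. -/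
noncomputable def mulTensor (α : A →ₐ[k] L) (β : B →ₐ[k] L) : A ⊗[k] B →ₗ[k] L :=
  LinearMap.mul' k L ∘ₗ TensorProduct.map α.toLinearMap β.toLinearMap

variable {α : A →ₐ[k] L} {β : B →ₐ[k] L}

theorem mulTensor_tmul (x : A) (y : B) : mulTensor α β (x ⊗ₜ y) = α x * β y := by
  simp [mulTensor]

theorem mulTensor_smul (r : A) (z : A ⊗[k] B) :
    mulTensor α β (r • z) = α r * mulTensor α β z := by
  induction z with
  | zero => simp
  | add x y hx hy => rw [smul_add, map_add, hx, hy, map_add, mul_add]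
  | tmul x y => simp [TensorProduct.smul_tmul', mulTensor_tmul, mul_assoc]

theorem mulTensor_mul (z : A ⊗[k] B) (y : B) :
    mulTensor α β (LinearMap.lTensor A (LinearMap.mulRight k y) z) = mulTensor α β z * β y := by
  induction z with
  | zero => simp
  | add x y hx hy => rw [map_add, map_add, hx, hy, map_add, add_mul]
  | tmul x y => simp [mulTensor_tmul, mul_assoc]

variable {ι κ : Type} [Fintype ι] [Fintype κ] (a : Module.Basis ι k A) (b : Module.Basis κ k B)
  (hm : Function.Bijective (mulTensor α β))

/-- If the products `β y * α x` factor `L` and the `β y` commute with the `α (a i)` up to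
automorphisms of the vector space `B`, then the products `α x * β y` factor `L` as well. -/
theorem bijective_mulTensor_of_commute {s : ι → B ≃ₗ[k] B}
    (hs : ∀ i y, β y * α (a i) = α (a i) * β (s i y)) (h : Function.Bijective (mulTensor β α)) :
    Function.Bijective (mulTensor α β) := by
  refine (Function.Bijective.of_comp_iff (mulTensor α β) a.bijective_sum_tmul_left).1 ?_
  convert h.comp (a.bijective_sum_tmul_right.comp
    (LinearEquiv.piCongrRight fun i => (s i).symm).bijective) using 1
  funext f
  simp [mulTensor_tmul, hs]

include hm in
theorem bijective_sum_mul_of_basis_left :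
    Function.Bijective fun f : ι → B => ∑ i, α (a i) * (β : B →+* L) (f i) := by
  convert hm.comp a.bijective_sum_tmul_left using 2 with f
  simp [mulTensor_tmul]

include hm in
theorem bijective_sum_mul_of_basis_right :
    Function.Bijective fun f : κ → A => ∑ i, (α : A →+* L) (f i) * β (b i) := by
  convert hm.comp b.bijective_sum_tmul_right using 2 with f
  simp [mulTensor_tmul]

/-- The extension of a linear map `φ : B → V` to an `A`-linear map `L → A ⊗ V`, where `L` is
identified with `A ⊗ B`. -/
noncomputable def extendTensor {V : Type u} [AddCommGroup V] [Module k V] :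
    (B →ₗ[k] V) →ₗ[k] L →ₗ[k] A ⊗[k] V :=
  (LinearMap.lcomp k _ (LinearEquiv.ofBijective _ hm).symm.toLinearMap) ∘ₗ LinearMap.lTensorHom A

section extendTensor

variable {V : Type u} [AddCommGroup V] [Module k V]

section

variable (φ : B →ₗ[k] V)

theorem extendTensor_mulTensor (z : A ⊗[k] B) :
    extendTensor hm φ (mulTensor α β z) = LinearMap.lTensor A φ z := by
  refine congr_arg (LinearMap.lTensor A φ) ?_
  exact (LinearEquiv.ofBijective _ hm).symm_apply_apply z

theorem extendTensor_mul_mul (x : A) (y : B) : extendTensor hm φ (α x * β y) = x ⊗ₜ φ y := by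
  rw [← mulTensor_tmul, extendTensor_mulTensor, LinearMap.lTensor_tmul]

theorem extendTensor_mul_left (r : A) (x : L) :
    extendTensor hm φ (α r * x) = r • extendTensor hm φ x := by
  obtain ⟨z, rfl⟩ := hm.2 x
  rw [← mulTensor_smul, extendTensor_mulTensor, extendTensor_mulTensor]
  exact (TensorProduct.AlgebraTensorModule.lTensor A A φ).map_smul r z

theorem extendTensor_mul_right (x : L) (y : B) :
    extendTensor hm φ (x * β y) = extendTensor hm (φ ∘ₗ LinearMap.mulRight k y) x := by
  obtain ⟨z, rfl⟩ := hm.2 x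
  rw [← mulTensor_mul, extendTensor_mulTensor, extendTensor_mulTensor, LinearMap.lTensor_comp,
    LinearMap.comp_apply]

end

variable (φ : ι → B →ₗ[k] V)

/-- The map `x ↦ ∑ i, φᵢ (x * α (a i))`, where `φᵢ : B → V` is extended to an `A`-linear map on
`L`. -/
noncomputable def twistSum : L →ₗ[k] A ⊗[k] V :=
  ∑ i, extendTensor hm (φ i) ∘ₗ LinearMap.mulRight k (α (a i))

theorem twistSum_apply (x : L) :
    twistSum a hm φ x = ∑ i, extendTensor hm (φ i) (x * α (a i)) := by
  simp [twistSum]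

theorem twistSum_mul_left (r : A) (x : L) :
    twistSum a hm φ (α r * x) = r • twistSum a hm φ x := by
  simp_rw [twistSum_apply, mul_assoc, extendTensor_mul_left, Finset.smul_sum]

theorem twistSum_add (ψ : ι → B →ₗ[k] V) :
    twistSum a hm (φ + ψ) = twistSum a hm φ + twistSum a hm ψ := by
  ext x
  simp [twistSum_apply, Finset.sum_add_distrib]

theorem twistSum_rightRep [DecidableEq ι] (l x : L) :
    twistSum a hm (fun i => ∑ j, φ j ∘ₗ LinearMap.mulRight k
      (rightRep (bijective_sum_mul_of_basis_left a hm) l i j)) x = twistSum a hm φ (x * l) := by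
  simp_rw [twistSum_apply, map_sum, LinearMap.sum_apply]
  rw [Finset.sum_comm]
  refine Finset.sum_congr rfl fun j _ => ?_
  rw [mul_assoc, ← sum_mul_rightRep (bijective_sum_mul_of_basis_left a hm) l j, Finset.mul_sum,
    map_sum]
  refine Finset.sum_congr rfl fun i _ => ?_
  rw [← extendTensor_mul_right, mul_assoc]
  rfl

variable {s : ι → B ≃ₗ[k] B} (hs : ∀ i y, β y * α (a i) = α (a i) * β (s i y))

include hs

theorem twistSum_of_commute (y : B) : twistSum a hm φ (β y) = ∑ i, a i ⊗ₜ φ i (s i y) := by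
  simp_rw [twistSum_apply, hs, extendTensor_mul_mul]

theorem twistSum_injective : Function.Injective (twistSum (V := V) a hm) := by
  intro φ ψ h
  ext i y
  obtain ⟨y, rfl⟩ := (s i).surjective y
  have := congr($h (β y))
  rw [twistSum_of_commute a hm φ hs, twistSum_of_commute a hm ψ hs] at this
  exact congr_fun (a.bijective_sum_tmul_left.1 this) i

theorem exists_twistSum_eq (f : B →ₗ[k] A ⊗[k] V) : ∃ φ, ∀ y, twistSum a hm φ (β y) = f y := by
  classical
  let N := TensorProduct.equivFinsuppOfBasisLeft (N := V) a
  refine ⟨fun i => Finsupp.lapply i ∘ₗ N.toLinearMap ∘ₗ f ∘ₗ (s i).symm.toLinearMap, fun y => ?_⟩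
  rw [twistSum_of_commute a hm _ hs]
  conv_rhs => rw [← N.symm_apply_apply (f y)]
  rw [TensorProduct.equivFinsuppOfBasisLeft_symm_apply, Finsupp.sum_fintype _ _ (by simp)]
  simp [N]

omit hs

end extendTensor

section Coinduced

variable (V : ModuleCat.{u} k)

/-- The elements of the coextension of scalars of a vector space `V` to `B` are the linear maps
`B → V`. -/
noncomputable def ModuleCat.CoextendScalars.toLinearMap :
    (ModuleCat.coextendScalars.{u, u, u} (algebraMap k B)).obj V →+ (B →ₗ[k] V) where
  toFun f :=
    { toFun := fun y => f y
      map_add' := fun x y => ModuleCat.CoextendScalars.apply_add f x y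
      map_smul' := fun c y =>
        (congr_arg (fun y : B => f y) (Algebra.smul_def c y)).trans
          (ModuleCat.CoextendScalars.apply_mul f c y) }
  map_zero' := rfl
  map_add' _ _ := rfl

variable {V} in
theorem ModuleCat.CoextendScalars.toLinearMap_smul (y : B)
    (f : (ModuleCat.coextendScalars.{u, u, u} (algebraMap k B)).obj V) :
    ModuleCat.CoextendScalars.toLinearMap V (y • f) =
      ModuleCat.CoextendScalars.toLinearMap V f ∘ₗ LinearMap.mulRight k y := rfl

theorem ModuleCat.CoextendScalars.toLinearMap_injective :
    Function.Injective (toLinearMap (B := B) V) := fun _ _ h =>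
  ext_apply fun y => LinearMap.congr_fun h y

theorem ModuleCat.CoextendScalars.toLinearMap_surjective :
    Function.Surjective (toLinearMap (B := B) V) := fun g =>
  ⟨mk _ V g.toAddMonoidHom fun c y =>
    (congr_arg g (Algebra.smul_def c y).symm).trans (g.map_smul c y), rfl⟩

/-- The map underlying `matrixRestrictCoextendIso`: it sends `φ` to the `A`-linear map
`twistSum φ : L → A ⊗ V`. -/
noncomputable def coextendTwist :
    (ι → (ModuleCat.coextendScalars.{u, u, u} (algebraMap k B)).obj V) →+
      (ModuleCat.coextendScalars.{u, u, u} (α : A →+* L)).obj (ModuleCat.of A (A ⊗[k] V)) where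
  toFun φ := ModuleCat.CoextendScalars.mk (α : A →+* L) (ModuleCat.of A (A ⊗[k] V))
    (twistSum a hm fun i => ModuleCat.CoextendScalars.toLinearMap V (φ i)).toAddMonoidHom
    (twistSum_mul_left a hm _)
  map_zero' := ModuleCat.CoextendScalars.ext_apply fun x =>
    (twistSum_apply a hm _ x).trans (Eq.trans (b := (0 : A ⊗[k] V)) (by simp) rfl)
  map_add' φ ψ := ModuleCat.CoextendScalars.ext_apply fun x =>
    LinearMap.congr_fun (twistSum_add a hm (fun i => ModuleCat.CoextendScalars.toLinearMap V (φ i))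
      fun i => ModuleCat.CoextendScalars.toLinearMap V (ψ i)) x

theorem coextendTwist_apply
    (φ : ι → (ModuleCat.coextendScalars.{u, u, u} (algebraMap k B)).obj V) (x : L) :
    coextendTwist a hm V φ x =
      twistSum a hm (fun i => ModuleCat.CoextendScalars.toLinearMap V (φ i)) x := rfl

theorem coextendTwist_bijective {s : ι → B ≃ₗ[k] B}
    (hs : ∀ i y, β y * α (a i) = α (a i) * β (s i y)) :
    Function.Bijective (coextendTwist a hm V) := by
  refine ⟨fun φ ψ h => ?_, fun f => ?_⟩
  · have h' : (twistSum a hm fun i => ModuleCat.CoextendScalars.toLinearMap V (φ i)) =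
        twistSum a hm fun i => ModuleCat.CoextendScalars.toLinearMap V (ψ i) :=
      LinearMap.ext fun x => congr($h x)
    funext i
    exact ModuleCat.CoextendScalars.toLinearMap_injective V
      (congr_fun (twistSum_injective a hm hs h') i)
  · let g : B →ₗ[k] A ⊗[k] V :=
      { toFun := fun y => f (β y)
        map_add' := fun y z =>
          (congr_arg (fun x : L => f x) (map_add β y z)).trans
            (ModuleCat.CoextendScalars.apply_add f _ _)
        map_smul' := fun c y => by
          refine (congr_arg (fun x : L => f x)
            (?_ : β (c • y) = (α : A →+* L) (algebraMap k A c) * β y)).trans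
            ((ModuleCat.CoextendScalars.apply_mul f _ _).trans
              (algebraMap_smul A c (show A ⊗[k] V from f (β y))))
          simp [Algebra.smul_def] }
    obtain ⟨φ, hφ⟩ := exists_twistSum_eq a hm hs g
    choose ψ hψ using fun i => ModuleCat.CoextendScalars.toLinearMap_surjective V (φ i)
    obtain rfl : φ = fun i => ModuleCat.CoextendScalars.toLinearMap V (ψ i) :=
      funext fun i => (hψ i).symm
    refine ⟨ψ, ModuleCat.CoextendScalars.ext_apply fun x => ?_⟩
    -- both sides are `A`-linear and agree on the image of `β`
    obtain ⟨z, rfl⟩ := hm.2 x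
    induction z with
    | zero =>
      rw [map_zero]
      exact (map_zero (ModuleCat.CoextendScalars.equiv _ _ _)).trans
        (map_zero (ModuleCat.CoextendScalars.equiv _ _ _)).symm
    | add z w hz hw =>
      rw [map_add]
      exact (ModuleCat.CoextendScalars.apply_add _ _ _).trans
        ((congr_arg₂ _ hz hw).trans (ModuleCat.CoextendScalars.apply_add _ _ _).symm)
    | tmul r y =>
      rw [mulTensor_tmul]
      exact (ModuleCat.CoextendScalars.apply_mul (α := (α : A →+* L)) _ r _).trans
        ((congr_arg _ (hφ y)).trans
          (ModuleCat.CoextendScalars.apply_mul (α := (α : A →+* L)) f r _).symm)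

/-- If the `β y` commute with the basis elements `α (a i)` up to automorphisms of the vector space
`B`, then extending a coinduced `B`-module `Hom(B, V)` to `L` yields the `L`-module coinduced from
the `A`-module `A ⊗ V`. -/
noncomputable def matrixRestrictCoextendIso [DecidableEq ι] {s : ι → B ≃ₗ[k] B}
    (hs : ∀ i y, β y * α (a i) = α (a i) * β (s i y)) :
    (matrixRestrict (rightRep (bijective_sum_mul_of_basis_left a hm))).obj
        ((ModuleCat.coextendScalars.{u, u, u} (algebraMap k B)).obj V) ≅
      (ModuleCat.coextendScalars.{u, u, u} (α : A →+* L)).obj (ModuleCat.of A (A ⊗[k] V)) :=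
  matrixRestrictIso _ _ _ (coextendTwist a hm V) (coextendTwist_bijective a hm V hs) fun l φ =>
    ModuleCat.CoextendScalars.ext_apply fun x => by
      refine Eq.trans ?_ (twistSum_rightRep a hm
        (fun i => ModuleCat.CoextendScalars.toLinearMap V (φ i)) l x)
      rw [coextendTwist_apply]
      simp_rw [map_sum, ModuleCat.CoextendScalars.toLinearMap_smul]

end Coinduced

theorem injective_coextendScalars {R S : Type u} [Ring R] [Ring S] (f : R →+* S)
    (M : ModuleCat.{u} R) [Injective M] :
    Injective ((ModuleCat.coextendScalars.{u, u, u} f).obj M) :=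
  Injective.injective_of_adjoint (ModuleCat.restrictCoextendScalarsAdj f) M

/-- An injective module over a `k`-algebra is a retract of a module which is coinduced from `k`. -/
noncomputable def retractCoextendScalars (I : ModuleCat.{u} B) [Injective I] :
    Retract I ((ModuleCat.coextendScalars.{u, u, u} (algebraMap k B)).obj
      ((ModuleCat.restrictScalars (algebraMap k B)).obj I)) :=
  let adj := ModuleCat.restrictCoextendScalarsAdj.{u, u, u} (algebraMap k B)
  have := adj.unit_mono_of_L_faithful I
  { i := adj.unit.app I
    r := Injective.factorThru (𝟙 I) _
    retract := Injective.comp_factorThru _ _ }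

include b hm in
/-- If `L` is the product of its subalgebras `A` and `B`, where the elements of `B` commute with a
basis of `A` up to automorphisms of the vector space `B`, then injectives generate the derived
category of `L` if they generate those of `A` and `B`. -/
theorem loc_injectives_eq_top_of_factorization
    [h₁ : HasDerivedCategory.{v} (ModuleCat.{u} A)] [h₂ : HasDerivedCategory.{v} (ModuleCat.{u} B)]
    [h₃ : HasDerivedCategory.{v} (ModuleCat.{u} L)] {s : ι → B ≃ₗ[k] B}
    (hs : ∀ i y, β y * α (a i) = α (a i) * β (s i y))
    (hA : Loc.{u} (injectivesInDegreeZero (ModuleCat.{u} A)) = ⊤)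
    (hB : Loc.{u} (injectivesInDegreeZero (ModuleCat.{u} B)) = ⊤) :
    Loc.{u} (injectivesInDegreeZero (ModuleCat.{u} L)) = ⊤ := by
  classical
  refine top_unique fun X _ P hP hinj => ?_
  have hinj' (I : ModuleCat.{u} L) (hI : Injective I) :
      P ((DerivedCategory.singleFunctor _ 0).obj I) := hinj _ ⟨I, hI, ⟨Iso.refl _⟩⟩
  suffices P ((DerivedCategory.singleFunctor _ 0).obj (ModuleCat.of L L)) by
    rw [hP.eq_top_of_prop_single_self this]
    trivial
  by_cases hL : Subsingleton L
  · exact hP.prop_single_of_isZero (ModuleCat.isZero_of_subsingleton (ModuleCat.of L L))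
  -- If one of the bases is empty, then `L = 0`; otherwise, the functors `matrixRestrict` are exact.
  have : Nonempty ι := by
    by_contra h
    rw [not_nonempty_iff] at h
    exact hL (bijective_sum_mul_of_basis_left a hm).2.subsingleton
  have : Nonempty κ := by
    by_contra h
    rw [not_nonempty_iff] at h
    exact hL (bijective_sum_mul_of_basis_right b hm).2.subsingleton
  have hcoextA (M : ModuleCat.{u} A) : P ((DerivedCategory.singleFunctor _ 0).obj
      ((ModuleCat.coextendScalars.{u, u, u} (α : A →+* L)).obj M)) := by
    refine hP.prop_single_of_iso
      (matrixRestrictLeftRepIso (bijective_sum_mul_of_basis_right b hm) M) ?_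
    refine hP.prop_single_matrixRestrict _ hA (fun I hI => ?_) M
    refine hP.prop_single_of_iso
      (matrixRestrictLeftRepIso (bijective_sum_mul_of_basis_right b hm) I).symm ?_
    exact hinj' _ (injective_coextendScalars _ _)
  refine hP.prop_single_of_iso
    (matrixRestrictRightRepSelfIso (bijective_sum_mul_of_basis_left a hm)) ?_
  refine hP.prop_single_matrixRestrict _ hB (fun I hI => ?_) _
  refine hP.prop_single_of_retract ((retractCoextendScalars (k := k) I).map (matrixRestrict _)) ?_
  exact hP.prop_single_of_iso (matrixRestrictCoextendIso a hm _ hs).symm (hcoextA _)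

end Factorization

/-! ### Twisted tensor products -/

section Graded

variable {k : Type*} [Field k] {Γ : Type*} [DecidableEq Γ] {B : Type*} [AddCommGroup B] [Module k B]
  (ℬ : Γ → Submodule k B) [DirectSum.Decomposition ℬ]

/-- The linear map which multiplies the homogeneous elements of degree `j` by `c j`. -/
noncomputable def rescale (c : Γ → k) : B →ₗ[k] B :=
  DirectSum.toModule k Γ B (fun j => c j • (ℬ j).subtype) ∘ₗ
    (DirectSum.decomposeLinearEquiv ℬ).toLinearMap

variable {ℬ} in
theorem rescale_of_mem (c : Γ → k) {j : Γ} {b : B} (hb : b ∈ ℬ j) : rescale ℬ c b = c j • b := by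
  lift b to ℬ j using hb
  simp [rescale]

theorem rescale_comp_of_mul_eq_one {c d : Γ → k} (h : ∀ j, c j * d j = 1) :
    rescale ℬ c ∘ₗ rescale ℬ d = LinearMap.id := by
  ext b
  induction b using DirectSum.Decomposition.inductionOn ℬ with
  | zero => simp
  | add x y hx hy => rw [map_add, map_add, hx, hy]
  | @homogeneous j b =>
    rw [LinearMap.comp_apply, rescale_of_mem d b.2, map_smul, rescale_of_mem c b.2, smul_smul,
      mul_comm, h, one_smul]
    rfl

/-- `rescale` by units, as a linear equivalence. -/
noncomputable def rescaleEquiv (c : Γ → kˣ) : B ≃ₗ[k] B :=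
  LinearEquiv.ofLinearMap (rescale ℬ fun j => c j) (rescale ℬ fun j => ((c j)⁻¹ : kˣ))
    (rescale_comp_of_mul_eq_one ℬ fun j => by simp) (rescale_comp_of_mul_eq_one ℬ fun j => by simp)

theorem exists_homogeneous_basis [FiniteDimensional k B] :
    ∃ (n : ℕ) (b : Module.Basis (Fin n) k B) (d : Fin n → Γ), ∀ i, b i ∈ ℬ (d i) := by
  let b := (DirectSum.Decomposition.isInternal ℬ).collectedBasis
    fun j => Module.Free.chooseBasis k (ℬ j)
  have : Finite (Σ j, Module.Free.ChooseBasisIndex k (ℬ j)) := Module.Finite.finite_basis b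
  let e := Finite.equivFin (Σ j, Module.Free.ChooseBasisIndex k (ℬ j))
  refine ⟨_, b.reindex e, fun i => (e.symm i).1, fun i => ?_⟩
  rw [Module.Basis.reindex_apply]
  exact DirectSum.IsInternal.collectedBasis_mem _ _ _

end Graded

namespace TwistedTensorProduct

variable {k : Type u} [Field k] {Γ₁ : Type v} {Γ₂ : Type w} [AddCommGroup Γ₁] [AddCommGroup Γ₂]
  [DecidableEq Γ₁] [DecidableEq Γ₂]
  {A B : Type u} [Ring A] [Algebra k A] [Ring B] [Algebra k B]
  (𝒜 : Γ₁ → Submodule k A) [GradedAlgebra 𝒜]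
  (ℬ : Γ₂ → Submodule k B) [GradedAlgebra ℬ] (t : Bicharacter Γ₁ Γ₂ k)

theorem tmul_add (a : A) (b b' : B) :
    tmul 𝒜 ℬ t a (b + b') = tmul 𝒜 ℬ t a b + tmul 𝒜 ℬ t a b' :=
  TensorProduct.tmul_add a b b'

theorem add_tmul (a a' : A) (b : B) :
    tmul 𝒜 ℬ t (a + a') b = tmul 𝒜 ℬ t a b + tmul 𝒜 ℬ t a' b :=
  TensorProduct.add_tmul a a' b

theorem tmul_smul (c : k) (a : A) (b : B) : tmul 𝒜 ℬ t a (c • b) = c • tmul 𝒜 ℬ t a b :=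
  TensorProduct.tmul_smul c a b

theorem tmul_zero (a : A) : tmul 𝒜 ℬ t a 0 = 0 := TensorProduct.tmul_zero B a

theorem zero_tmul (b : B) : tmul 𝒜 ℬ t 0 b = 0 := TensorProduct.zero_tmul A b

/-- Multiplication by `a' ⊗ b'` on the right is untwisted on elements of the form `a ⊗ 1`. -/
theorem tmul_one_mul_tmul (a a' : A) (b' : B) :
    tmul 𝒜 ℬ t a 1 * tmul 𝒜 ℬ t a' b' = tmul 𝒜 ℬ t (a * a') b' := by
  induction a' using DirectSum.Decomposition.inductionOn 𝒜 with
  | zero => rw [zero_tmul, mul_zero, mul_zero, zero_tmul]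
  | add x y hx hy => rw [add_tmul, mul_add, hx, hy, mul_add, add_tmul]
  | homogeneous a' =>
    rw [tmul_mul_tmul t a b' a'.2 SetLike.GradedOne.one_mem, t.map_zero_right, Units.val_one,
      one_smul, one_mul]

/-- Multiplication by `1 ⊗ b'` on the right is untwisted. -/
theorem tmul_mul_one_tmul (a : A) (b b' : B) :
    tmul 𝒜 ℬ t a b * tmul 𝒜 ℬ t 1 b' = tmul 𝒜 ℬ t a (b * b') := by
  induction b using DirectSum.Decomposition.inductionOn ℬ with
  | zero => rw [tmul_zero, zero_mul, zero_mul, tmul_zero]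
  | add x y hx hy => rw [tmul_add, add_mul, hx, hy, add_mul, tmul_add]
  | homogeneous b =>
    rw [tmul_mul_tmul t a b' SetLike.GradedOne.one_mem b.2, t.map_zero_left, Units.val_one,
      one_smul, mul_one]

variable {𝒜} in
theorem one_tmul_mul_tmul_one {i : Γ₁} {a : A} (ha : a ∈ 𝒜 i) (b : B) :
    tmul 𝒜 ℬ t 1 b * tmul 𝒜 ℬ t a 1 = tmul 𝒜 ℬ t a (rescaleEquiv ℬ (t.toFun i) b) := by
  induction b using DirectSum.Decomposition.inductionOn ℬ with
  | zero => rw [tmul_zero, zero_mul, map_zero, tmul_zero]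
  | add x y hx hy => rw [tmul_add, add_mul, hx, hy, map_add, tmul_add]
  | homogeneous b =>
    rw [tmul_mul_tmul t 1 1 ha b.2, one_mul, mul_one, ← tmul_smul]
    exact congr_arg _ (rescale_of_mem (fun j => (t.toFun i j : k)) b.2).symm

/-- The inclusion `a ↦ a ⊗ 1`. -/
noncomputable def includeLeft : A →ₐ[k] TwistedTensorProduct 𝒜 ℬ t :=
  AlgHom.ofLinearMap ((of 𝒜 ℬ t).toLinearMap ∘ₗ (TensorProduct.mk k A B).flip 1) rfl
    fun a a' => (tmul_one_mul_tmul 𝒜 ℬ t a a' 1).symm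

/-- The inclusion `b ↦ 1 ⊗ b`. -/
noncomputable def includeRight : B →ₐ[k] TwistedTensorProduct 𝒜 ℬ t :=
  AlgHom.ofLinearMap ((of 𝒜 ℬ t).toLinearMap ∘ₗ TensorProduct.mk k A B 1) rfl
    fun b b' => (tmul_mul_one_tmul 𝒜 ℬ t 1 b b').symm

theorem includeLeft_apply (a : A) : includeLeft 𝒜 ℬ t a = tmul 𝒜 ℬ t a 1 := rfl

theorem includeRight_apply (b : B) : includeRight 𝒜 ℬ t b = tmul 𝒜 ℬ t 1 b := rfl

theorem includeLeft_mul_includeRight (a : A) (b : B) :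
    includeLeft 𝒜 ℬ t a * includeRight 𝒜 ℬ t b = tmul 𝒜 ℬ t a b := by
  rw [includeLeft_apply, includeRight_apply, tmul_mul_one_tmul, one_mul]

/-- In the opposite algebra of `A ⊗ᵗ B`, the multiplication map from `Bᵐᵒᵖ ⊗ Aᵐᵒᵖ` is the
identification of the underlying vector spaces. -/
theorem bijective_mulTensor_op :
    Function.Bijective (mulTensor (includeRight 𝒜 ℬ t).op (includeLeft 𝒜 ℬ t).op) := by
  let e : Bᵐᵒᵖ ⊗[k] Aᵐᵒᵖ ≃ₗ[k] (TwistedTensorProduct 𝒜 ℬ t)ᵐᵒᵖ :=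
    TensorProduct.comm k _ _ ≪≫ₗ TensorProduct.congr (MulOpposite.opLinearEquiv k).symm
      (MulOpposite.opLinearEquiv k).symm ≪≫ₗ of 𝒜 ℬ t ≪≫ₗ MulOpposite.opLinearEquiv k
  have he : mulTensor (includeRight 𝒜 ℬ t).op (includeLeft 𝒜 ℬ t).op = e.toLinearMap := by
    refine TensorProduct.ext' fun b a => ?_
    rw [mulTensor_tmul]
    exact congr_arg MulOpposite.op (includeLeft_mul_includeRight 𝒜 ℬ t a.unop b.unop)
  rw [he]
  exact e.bijective

end TwistedTensorProduct

theorem theoremD {k : Type u} [Field k]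
    {Γ₁ : Type v} {Γ₂ : Type w} [AddCommGroup Γ₁] [AddCommGroup Γ₂]
    [DecidableEq Γ₁] [DecidableEq Γ₂]
    {A B : Type u} [Ring A] [Algebra k A] [FiniteDimensional k A]
    [Ring B] [Algebra k B] [FiniteDimensional k B]
    (𝒜 : Γ₁ → Submodule k A) [GradedAlgebra 𝒜]
    (ℬ : Γ₂ → Submodule k B) [GradedAlgebra ℬ]
    (t : Bicharacter Γ₁ Γ₂ k)
    (hA : InjectivesGenerate A) (hB : InjectivesGenerate B) :
    InjectivesGenerate (TwistedTensorProduct 𝒜 ℬ t) := by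
  obtain ⟨n, a, d, ha⟩ := exists_homogeneous_basis 𝒜
  -- In the opposite algebra, `y` times `a i` is `a i ⊗ y`, and `a i` times `y` is `a i ⊗ y` with
  -- `y` rescaled by `t(d i, |y|)`; hence the inverse.
  let s (i : Fin n) : Bᵐᵒᵖ ≃ₗ[k] Bᵐᵒᵖ := (MulOpposite.opLinearEquiv k).symm ≪≫ₗ
    (rescaleEquiv ℬ (t.toFun (d i))).symm ≪≫ₗ MulOpposite.opLinearEquiv k
  let a' : Module.Basis (Fin n) k Aᵐᵒᵖ := a.map (MulOpposite.opLinearEquiv k)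
  have hs (i : Fin n) (y : Bᵐᵒᵖ) :
      (TwistedTensorProduct.includeRight 𝒜 ℬ t).op y *
          (TwistedTensorProduct.includeLeft 𝒜 ℬ t).op (a' i) =
        (TwistedTensorProduct.includeLeft 𝒜 ℬ t).op (a' i) *
          (TwistedTensorProduct.includeRight 𝒜 ℬ t).op (s i y) := by
    refine congr_arg MulOpposite.op
      (?_ : TwistedTensorProduct.includeLeft 𝒜 ℬ t (a i) *
          TwistedTensorProduct.includeRight 𝒜 ℬ t y.unop =
        TwistedTensorProduct.tmul 𝒜 ℬ t 1 ((rescaleEquiv ℬ (t.toFun (d i))).symm y.unop) *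
          TwistedTensorProduct.tmul 𝒜 ℬ t (a i) 1)
    rw [TwistedTensorProduct.includeLeft_mul_includeRight,
      TwistedTensorProduct.one_tmul_mul_tmul_one ℬ t (ha i), LinearEquiv.apply_symm_apply]
  exact loc_injectives_eq_top_of_factorization
    (h₁ := HasDerivedCategory.standard _) (h₂ := HasDerivedCategory.standard _)
    (h₃ := HasDerivedCategory.standard _) a' (Module.finBasis k Bᵐᵒᵖ)
    (bijective_mulTensor_of_commute a' hs (TwistedTensorProduct.bijective_mulTensor_op 𝒜 ℬ t))
    hs hA hB
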